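/- Let $m_1,m_2$ be nonnegative integers, $m=m_1+m_2$, $0<a\le\infty$, and $\Omega_a=\{(x,t):0\le x<\infty,\ 0\le t<a\}$. Let $v(x,t)$ be a complex $m_1\times m_2$ matrix function that is continuously differentiable on $\Omega_a$ (one-sided derivatives at the boundary) and such that $v_{xx}$ exists on $\Omega_a$. Assume that $v$ satisfies the matrix defocusing nonlinear Schrödinger equation $2v_t=\mathrm{i}\,(v_{xx}-2vv^*v)$ on $\Omega_a$, and that for every $t\in[0,a)$ there is a real $M(t)$ with $\sup_{x>0,\ 0\le s\le t}\|v(x,s)\|\le M(t)$. Put $$j=\begin{bmatrix}I_{m_1}&0\\0&-I_{m_2}\end{bmatrix},\quad V=\begin{bmatrix}0&v\\v^*&0\end{bmatrix},\quad G=\mathrm{i}(zj+jV),\quad F=-\mathrm{i}\Big(z^2j+zjV-\tfrac12\big(\mathrm{i}V_x-jV^2\big)\Big).$$ A Weyl function of the Dirac system $y_x=G(x,t,z)y$, $x\ge0$ ($t$ fixed), is an $m_2\times m_1$ matrix function $\varphi(z)$ holomorphic in $\mathbb C_+=\{\Im z>0\}$ such that for all $z\in\mathbb C_+$ $$\int_0^\infty\begin{bmatrix}I_{m_1}&\varphi(z)^*\end{bmatrix}u(x,z)^*u(x,z)\begin{bmatrix}I_{m_1}\\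 \varphi(z)\end{bmatrix}dx<\infty,$$ where $u$ is the fundamental solution of the system normalized by $u(0,z)=I_m$. Let $R(x,t,z)$ be the solution of $R_t=FR$, $R(x,0,z)=I_m$ ($x\ge 0$, $0\le t<a$, $z\in\mathbb C$), and let $R_{ik}(t,z)$ be the $m_i\times m_k$ blocks of $R(0,t,z)$. Then $R$ exists; for every $t\in[0,a)$ the system $y_x=G(x,t,z)y$ has a Weyl function $\varphi(t,\cdot)$, unique on $\mathbb C_+$; and for all $t\in[0,a)$ and $z\in\mathbb C_+$ the matrix $R_{11}(t,z)+R_{12}(t,z)\varphi(0,z)$ is invertible and $$\varphi(t,z)=\big(R_{21}(t,z)+R_{22}(t,z)\varphi(0,z)\big)\big(R_{11}(t,z)+R_{12}(t,z)\varphi(0,z)\big)^{-1}.$$ -/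

import Mathlib

open Set MeasureTheory
open scoped Matrix Matrix.Norms.L2Operator

namespace DNLS

noncomputable section

/-- The semistrip `Ω_a = {(x, t) : 0 ≤ x < ∞, 0 ≤ t < a}`, where `a = ∞` is allowed. -/
def semistrip (a : EReal) : Set (ℝ × ℝ) :=
  {p | 0 ≤ p.1 ∧ 0 ≤ p.2 ∧ (p.2 : EReal) < a}

/-- The open upper half-plane `ℂ₊`. -/
def upperHalf : Set ℂ := {z | 0 < z.im}

/-- The partial derivative `v_x` on the quarter-plane (one-sided at `x = 0`). -/
def partialX {m₁ m₂ : ℕ} (v : ℝ → ℝ → Matrix (Fin m₁) (Fin m₂) ℂ) (x t : ℝ) :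
    Matrix (Fin m₁) (Fin m₂) ℂ :=
  derivWithin (fun y => v y t) (Ici 0) x

/-- The partial derivative `v_t` on the quarter-plane (one-sided at `t = 0`). -/
def partialT {m₁ m₂ : ℕ} (v : ℝ → ℝ → Matrix (Fin m₁) (Fin m₂) ℂ) (x t : ℝ) :
    Matrix (Fin m₁) (Fin m₂) ℂ :=
  derivWithin (fun s => v x s) (Ici 0) t

/-- The second partial derivative `v_xx` (meaningful where `v_x` is differentiable in `x`). -/
def partialXX {m₁ m₂ : ℕ} (v : ℝ → ℝ → Matrix (Fin m₁) (Fin m₂) ℂ) :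
    ℝ → ℝ → Matrix (Fin m₁) (Fin m₂) ℂ :=
  partialX (partialX v)

/-- `j = diag(I_{m₁}, -I_{m₂})`. -/
def jMat (m₁ m₂ : ℕ) : Matrix (Fin m₁ ⊕ Fin m₂) (Fin m₁ ⊕ Fin m₂) ℂ :=
  Matrix.fromBlocks 1 0 0 (-1)

/-- `V = [[0, v], [v*, 0]]`. -/
def potential {m₁ m₂ : ℕ} (w : Matrix (Fin m₁) (Fin m₂) ℂ) :
    Matrix (Fin m₁ ⊕ Fin m₂) (Fin m₁ ⊕ Fin m₂) ℂ :=
  Matrix.fromBlocks 0 w wᴴ 0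

/-- The coefficient `G = i (z j + j V)` of the Dirac system, where `V` is built from `w`. -/
def coeffG {m₁ m₂ : ℕ} (w : Matrix (Fin m₁) (Fin m₂) ℂ) (z : ℂ) :
    Matrix (Fin m₁ ⊕ Fin m₂) (Fin m₁ ⊕ Fin m₂) ℂ :=
  Complex.I • (z • jMat m₁ m₂ + jMat m₁ m₂ * potential w)

/-- The coefficient `F = -i (z² j + z j V - (i V_x - j V²) / 2)` of the second auxiliary system,
where `V` is built from `w` and `V_x` from `wx`. -/
def coeffF {m₁ m₂ : ℕ} (w wx : Matrix (Fin m₁) (Fin m₂) ℂ) (z : ℂ) :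
    Matrix (Fin m₁ ⊕ Fin m₂) (Fin m₁ ⊕ Fin m₂) ℂ :=
  -Complex.I • (z ^ 2 • jMat m₁ m₂ + z • (jMat m₁ m₂ * potential w)
    - (1 / 2 : ℂ) • (Complex.I • potential wx - jMat m₁ m₂ * potential w ^ 2))

/-- `u` is, on `[0, ∞)`, the fundamental solution of the Dirac system `u' = i (z j + j V(x)) u`
normalized by `u(0) = I_m`. It is used for continuous potentials `w`, so solutions are classical. -/
def IsFundamentalSolution {m₁ m₂ : ℕ} (w : ℝ → Matrix (Fin m₁) (Fin m₂) ℂ) (z : ℂ)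
    (u : ℝ → Matrix (Fin m₁ ⊕ Fin m₂) (Fin m₁ ⊕ Fin m₂) ℂ) : Prop :=
  u 0 = 1 ∧ ∀ x : ℝ, 0 ≤ x → HasDerivWithinAt u (coeffG (w x) z * u x) (Ici 0) x

/-- The `m₁ × m₁` matrix `[I C*] U* U [I; C]`. -/
def weylIntegrand {m₁ m₂ : ℕ} (U : Matrix (Fin m₁ ⊕ Fin m₂) (Fin m₁ ⊕ Fin m₂) ℂ)
    (C : Matrix (Fin m₂) (Fin m₁) ℂ) : Matrix (Fin m₁) (Fin m₁) ℂ :=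
  (Matrix.fromCols (1 : Matrix (Fin m₁) (Fin m₁) ℂ) Cᴴ) * Uᴴ * U *
    (Matrix.fromRows (1 : Matrix (Fin m₁) (Fin m₁) ℂ) C)

/-- `φ` is a Weyl function of the Dirac system with potential `w` on `[0, ∞)`: it is holomorphic
in `ℂ₊` with values in the `m₂ × m₁` matrices and, for every `z ∈ ℂ₊`,
`∫₀^∞ [I φ(z)*] u(x,z)* u(x,z) [I; φ(z)] dx < ∞`. Values of `φ` outside `ℂ₊` play no role. -/
def IsWeylFunction {m₁ m₂ : ℕ} (w : ℝ → Matrix (Fin m₁) (Fin m₂) ℂ)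
    (φ : ℂ → Matrix (Fin m₂) (Fin m₁) ℂ) : Prop :=
  DifferentiableOn ℂ φ upperHalf ∧
  ∀ z ∈ upperHalf, ∃ u : ℝ → Matrix (Fin m₁ ⊕ Fin m₂) (Fin m₁ ⊕ Fin m₂) ℂ,
    IsFundamentalSolution w z u ∧
    IntegrableOn (fun x => weylIntegrand (u x) (φ z)) (Ioi 0)

/-- `R(x,t,z)` solves `R_t = F R`, `R(x,0,z) = I_m`, on `Ω_a` for all `z ∈ ℂ`. -/
def IsTimeEvolution {m₁ m₂ : ℕ} (a : EReal) (v : ℝ → ℝ → Matrix (Fin m₁) (Fin m₂) ℂ)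
    (R : ℝ → ℝ → ℂ → Matrix (Fin m₁ ⊕ Fin m₂) (Fin m₁ ⊕ Fin m₂) ℂ) : Prop :=
  ∀ (x : ℝ) (z : ℂ), 0 ≤ x →
    R x 0 z = 1 ∧
    ∀ t : ℝ, 0 ≤ t → (t : EReal) < a →
      HasDerivWithinAt (fun s => R x s z) (coeffF (v x t) (partialX v x t) z * R x t z) (Ici 0) t

/-- `v` satisfies the matrix defocusing NLS equation `2 v_t = i (v_xx - 2 v v* v)` on `Ω_a`,
the derivative `v_xx` being required to exist. -/
def SolvesDNLS {m₁ m₂ : ℕ} (a : EReal) (v : ℝ → ℝ → Matrix (Fin m₁) (Fin m₂) ℂ) : Prop :=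
  ∀ x t : ℝ, (x, t) ∈ semistrip a →
    DifferentiableWithinAt ℝ (fun y => partialX v y t) (Ici 0) x ∧
    (2 : ℂ) • partialT v x t =
      Complex.I • (partialXX v x t - (2 : ℂ) • (v x t * (v x t)ᴴ * v x t))

end

end DNLS

/-! The nonlinear equation is the compatibility condition of `y_x = G y` and `y_t = F y`
(`zero_curvature`). It yields `R_x = G(x,t) R - R G(x,0)`, and hence, by uniqueness for linear
equations, the factorization `u(x,t) R(0,t) = R(x,t) u(x,0)`
(`fundamentalSolution_mul_timeEvolution`). It remains to see that `R(0,t)` carries the Weyl solution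
at time `0` to the one at time `t`.

The tool is the indefinite form `y* j y`. For `Im z > 0` it decreases along solutions of the Dirac
system, at the rate `2 Im z` times the squared norm. The matrices `C` for which `u(x) [I; C]` is
`j`-nonnegative therefore form nested discs, whose diameter tends to zero as `x → ∞`
(`InWeylDisc.norm_sub_le`). Their common point is holomorphic in `z` and makes the Weyl integral
finite; no other matrix does, because solutions starting at `[0; d]` do not decay.

By the factorization, the transported Weyl solution stays `j`-nonnegative for all `x > 0` as soon as
`R(x,t,z)` does not decrease the form. Its rate of change along `R` is governed by `2 Im z (2 Re z +
V)`, from which `V_x` has cancelled. So boundedness of `v` alone suffices, provided `Re z` is large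
(`IsTimeEvolution.jForm_le`). There the transported point lies in every disc at time `t` and must be
`φ(t,z)`.

Written without an inverse, `φ(t) (R₁₁ + R₁₂ φ(0)) = R₂₁ + R₂₂ φ(0)`, the formula has holomorphic
sides and extends to all of `ℂ₊` by the identity theorem (`weylFunction_mul_eq`). Invertibility
follows afterwards: a kernel vector of the upper block would also kill the lower block,
contradicting the invertibility of `R`. -/

namespace DNLS

open Filter Topology

/-! ### Linear differential equations: existence, uniqueness, dependence on parameters. -/

section LinearODE

variable {X : Type*} [NormedAddCommGroup X] [NormedSpace ℝ X]

/-- The terms of the Dyson series of the linear equation `y' = A y`, `y 0 = y₀`. -/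
noncomputable def dysonTerm (A : ℝ → X →L[ℝ] X) (y₀ : X) : ℕ → ℝ → X
  | 0, _ => y₀
  | n + 1, t => ∫ s in (0 : ℝ)..t, A s (dysonTerm A y₀ n s)

theorem continuous_dysonTerm {A : ℝ → X →L[ℝ] X} (hA : Continuous A) (y₀ : X) (n : ℕ) :
    Continuous (dysonTerm A y₀ n) := by
  induction n with
  | zero => exact continuous_const
  | succ n ih =>
    exact intervalIntegral.continuous_primitive
      (fun a b => (hA.clm_apply ih).intervalIntegrable a b) 0

theorem hasDerivAt_dysonTerm_succ [CompleteSpace X] {A : ℝ → X →L[ℝ] X} (hA : Continuous A)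
    (y₀ : X) (n : ℕ) (t : ℝ) :
    HasDerivAt (dysonTerm A y₀ (n + 1)) (A t (dysonTerm A y₀ n t)) t := by
  have hc : Continuous fun s => A s (dysonTerm A y₀ n s) :=
    hA.clm_apply (continuous_dysonTerm hA y₀ n)
  exact intervalIntegral.integral_hasDerivAt_right (hc.intervalIntegrable _ _)
    hc.aestronglyMeasurable.stronglyMeasurableAtFilter hc.continuousAt

theorem norm_dysonTerm_le {A : ℝ → X →L[ℝ] X} {K : ℝ} (hK : ∀ t, ‖A t‖ ≤ K)
    (y₀ : X) (n : ℕ) {t : ℝ} (ht : 0 ≤ t) :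
    ‖dysonTerm A y₀ n t‖ ≤ ‖y₀‖ * ((K * t) ^ n / n.factorial) := by
  have hK0 : 0 ≤ K := (norm_nonneg _).trans (hK 0)
  induction n generalizing t with
  | zero => simp [dysonTerm]
  | succ n ih =>
    have h1 : ‖dysonTerm A y₀ (n + 1) t‖ ≤
        ∫ s in (0 : ℝ)..t, (‖y₀‖ * K ^ (n + 1) / n.factorial) * s ^ n := by
      refine intervalIntegral.norm_integral_le_of_norm_le ht (ae_of_all _ fun s hs => ?_)
        (Continuous.intervalIntegrable (by fun_prop) _ _)
      calc ‖A s (dysonTerm A y₀ n s)‖ ≤ K * (‖y₀‖ * ((K * s) ^ n / n.factorial)) :=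
            ((A s).le_opNorm _).trans (mul_le_mul (hK s) (ih hs.1.le) (norm_nonneg _) hK0)
        _ = _ := by rw [mul_pow]; ring
    refine h1.trans_eq ?_
    rw [intervalIntegral.integral_const_mul, integral_pow, Nat.factorial_succ]
    have : (n.factorial : ℝ) ≠ 0 := by positivity
    push_cast
    field_simp
    ring

/-- The factorial bound on the iterated integrals makes their series, and the series of derivatives,
converge uniformly on every bounded interval of `[0, ∞)`, so no continuation of local solutions is
needed. -/
theorem exists_linearODE_of_bounded [CompleteSpace X] {A : ℝ → X →L[ℝ] X} (hA : Continuous A)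
    {K : ℝ} (hK : ∀ t, ‖A t‖ ≤ K) (y₀ : X) :
    ∃ y : ℝ → X, y 0 = y₀ ∧ ∀ t, 0 ≤ t → HasDerivWithinAt y (A t (y t)) (Ici 0) t := by
  have hK0 : 0 ≤ K := (norm_nonneg _).trans (hK 0)
  let f := dysonTerm A y₀
  have hsum : ∀ S : ℝ, Summable fun n : ℕ => ‖y₀‖ * ((K * S) ^ n / n.factorial) := fun S =>
    (Real.summable_pow_div_factorial (K * S)).mul_left _
  have hle : ∀ n {t S : ℝ}, 0 ≤ t → t ≤ S → ‖f n t‖ ≤ ‖y₀‖ * ((K * S) ^ n / n.factorial) := by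
    intro n t S h0 h1
    refine (norm_dysonTerm_le hK y₀ n h0).trans ?_
    gcongr
  have hs : ∀ t, 0 ≤ t → Summable fun n => f n t := fun t ht =>
    Summable.of_norm_bounded (hsum t) fun n => hle n ht le_rfl
  let y : ℝ → X := fun t => ∑' n, f n t
  have hcont : ContinuousOn y (Ici 0) := by
    intro t ht
    have : ContinuousOn y (Icc 0 (t + 1)) :=
      continuousOn_tsum (fun n => (continuous_dysonTerm hA y₀ n).continuousOn) (hsum (t + 1))
        fun n s hs => hle n hs.1 hs.2
    refine (this t ⟨ht, by linarith⟩).mono_of_mem_nhdsWithin ?_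
    rw [← Ici_inter_Iic]
    exact inter_mem_nhdsWithin _ (Iic_mem_nhds (by linarith))
  have h0 : y 0 = y₀ := by
    change ∑' n, f n 0 = y₀
    rw [tsum_eq_single 0]
    · rfl
    · intro n hn
      obtain ⟨k, rfl⟩ := Nat.exists_eq_succ_of_ne_zero hn
      simp [f, dysonTerm]
  have hder : ∀ t, 0 < t → HasDerivAt y (A t (y t)) t := by
    intro t ht
    have hsucc : HasDerivAt (fun t => ∑' n, f (n + 1) t) (∑' n, A t (f n t)) t := by
      refine hasDerivAt_tsum_of_isPreconnected (u := fun n : ℕ =>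
        K * (‖y₀‖ * ((K * (t + 1)) ^ n / n.factorial))) (t := Ioo 0 (t + 1)) (y₀ := t)
        ((hsum (t + 1)).mul_left K) isOpen_Ioo isPreconnected_Ioo
        (fun n s _ => hasDerivAt_dysonTerm_succ hA y₀ n s) ?_ ⟨ht, by linarith⟩ ?_
        ⟨ht, by linarith⟩
      · intro n s hs
        exact ((A s).le_opNorm _).trans
          (mul_le_mul (hK s) (hle n hs.1.le hs.2.le) (norm_nonneg _) hK0)
      · exact (summable_nat_add_iff 1).2 (hs t ht.le)
    have heq : y =ᶠ[𝓝 t] fun t => y₀ + ∑' n, f (n + 1) t := by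
      filter_upwards [lt_mem_nhds ht] with s hs'
      exact (hs s hs'.le).tsum_eq_zero_add
    have h2 := (hsucc.const_add y₀).congr_of_eventuallyEq heq
    rwa [← (A t).map_tsum (hs t ht.le)] at h2
  refine ⟨y, h0, fun t ht => ?_⟩
  rcases ht.eq_or_lt with rfl | ht
  -- The series is controlled only for `t ≥ 0`, so at the endpoint the one-sided derivative is
  -- obtained as the limit of the derivatives at `t > 0`.
  · refine hasDerivWithinAt_Ici_of_tendsto_deriv (s := Ioi 0)
      (fun s hs => (hder s hs).differentiableAt.differentiableWithinAt)
      ((hcont 0 self_mem_Ici).mono Ioi_subset_Ici_self) self_mem_nhdsWithin ?_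
    have : Tendsto (fun s => A s (y s)) (𝓝[>] 0) (𝓝 (A 0 (y 0))) :=
      ((hA.continuousOn.clm_apply hcont) 0 self_mem_Ici).mono Ioi_subset_Ici_self
    refine this.congr' ?_
    filter_upwards [self_mem_nhdsWithin] with s hs
    exact (hder s hs).deriv.symm
  · exact (hder t ht).hasDerivWithinAt

/-- Linear equations have at most one solution: a solution vanishing at `0` vanishes. -/
theorem linearODE_eq_zero {A : ℝ → X →L[ℝ] X} {T : ℝ} (hA : ContinuousOn A (Icc 0 T))
    {y : ℝ → X} (hy : ∀ t ∈ Icc 0 T, HasDerivWithinAt y (A t (y t)) (Ici 0) t) (h0 : y 0 = 0) :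
    ∀ t ∈ Icc 0 T, y t = 0 := by
  obtain ⟨K, hK⟩ := isCompact_Icc.exists_bound_of_continuousOn hA
  refine eq_zero_of_abs_deriv_le_mul_abs_self_of_eq_zero_right (K := K)
    (f' := fun t => A t (y t)) ?_ ?_ h0 ?_
  · exact fun t ht => (hy t ht).continuousWithinAt.mono Icc_subset_Ici_self
  · exact fun t ht => (hy t (Ico_subset_Icc_self ht)).mono (Ici_subset_Ici.2 ht.1)
  · exact fun t ht => ((A t).le_opNorm _).trans
      (mul_le_mul_of_nonneg_right (hK t (Ico_subset_Icc_self ht)) (norm_nonneg _))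

theorem linearODE_unique {A : ℝ → X →L[ℝ] X} {T : ℝ} (hA : ContinuousOn A (Icc 0 T))
    {y y' : ℝ → X} (hy : ∀ t ∈ Icc 0 T, HasDerivWithinAt y (A t (y t)) (Ici 0) t)
    (hy' : ∀ t ∈ Icc 0 T, HasDerivWithinAt y' (A t (y' t)) (Ici 0) t) (h0 : y 0 = y' 0) :
    ∀ t ∈ Icc 0 T, y t = y' t := by
  intro t ht
  refine sub_eq_zero.1 (linearODE_eq_zero (y := fun t => y t - y' t) hA (fun s hs => ?_)
    (sub_eq_zero.2 h0) t ht)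
  exact ((hy s hs).fun_sub (hy' s hs)).congr_deriv (map_sub _ _ _).symm

theorem exists_linearODE_Icc [CompleteSpace X] {A : ℝ → X →L[ℝ] X} {T : ℝ} (hT : 0 ≤ T)
    (hA : ContinuousOn A (Icc 0 T)) (y₀ : X) :
    ∃ y : ℝ → X, y 0 = y₀ ∧ ∀ t ∈ Icc 0 T, HasDerivWithinAt y (A t (y t)) (Ici 0) t := by
  have hc : Continuous fun t => A (projIcc 0 T hT t) :=
    hA.comp_continuous (continuous_subtype_val.comp continuous_projIcc)
      fun t => (projIcc 0 T hT t).2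
  obtain ⟨K, hK⟩ := isCompact_Icc.exists_bound_of_continuousOn hA
  obtain ⟨y, h0, hy⟩ := exists_linearODE_of_bounded hc (fun t => hK _ (projIcc 0 T hT t).2) y₀
  refine ⟨y, h0, fun t ht => ?_⟩
  have := hy t ht.1
  rwa [projIcc_of_mem hT ht] at this

/-- The coefficient may blow up at `a`, so solutions on compact intervals are glued by uniqueness.
-/
theorem exists_linearODE [CompleteSpace X] (a : EReal) {A : ℝ → X →L[ℝ] X}
    (hA : ContinuousOn A {t | 0 ≤ t ∧ (t : EReal) < a}) (y₀ : X) :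
    ∃ y : ℝ → X, y 0 = y₀ ∧
      ∀ t : ℝ, 0 ≤ t → (t : EReal) < a → HasDerivWithinAt y (A t (y t)) (Ici 0) t := by
  have hAT : ∀ T : ℝ, (T : EReal) < a → ContinuousOn A (Icc 0 T) := fun T hT =>
    hA.mono fun t ht => ⟨ht.1, lt_of_le_of_lt (EReal.coe_le_coe_iff.2 ht.2) hT⟩
  have hex : ∀ T : ℝ, ∃ y : ℝ → X, y 0 = y₀ ∧ (0 ≤ T → (T : EReal) < a →
      ∀ t ∈ Ico 0 T, HasDerivWithinAt y (A t (y t)) (Ici 0) t) := by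
    intro T
    by_cases hT : 0 ≤ T ∧ (T : EReal) < a
    · obtain ⟨y, h0, hy⟩ := exists_linearODE_Icc hT.1 (hAT T hT.2) y₀
      exact ⟨y, h0, fun _ _ t ht => hy t (Ico_subset_Icc_self ht)⟩
    · exact ⟨fun _ => y₀, rfl, fun h1 h2 => absurd ⟨h1, h2⟩ hT⟩
  choose Y hY0 hY using hex
  have hTex : ∀ t : ℝ, (t : EReal) < a → ∃ T : ℝ, (t : EReal) < a → t < T ∧ (T : EReal) < a := by
    intro t ht
    obtain ⟨T, h1, h2⟩ := EReal.lt_iff_exists_real_btwn.1 ht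
    exact ⟨T, fun _ => ⟨EReal.coe_lt_coe_iff.1 h1, h2⟩⟩
  have huniq : ∀ T T' : ℝ, (T : EReal) < a → (T' : EReal) < a → ∀ t, 0 ≤ t → t < T → t < T' →
      Y T t = Y T' t := by
    intro T T' hT hT' t h0 h1 h2
    refine linearODE_unique (T := t) (hAT t (lt_of_le_of_lt (EReal.coe_le_coe_iff.2 h1.le) hT))
      (fun s hs => hY T (by linarith) hT s ⟨hs.1, by linarith [hs.2]⟩)
      (fun s hs => hY T' (by linarith) hT' s ⟨hs.1, by linarith [hs.2]⟩)
      (by rw [hY0, hY0]) t ⟨h0, le_rfl⟩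
  have hτ : ∀ t : ℝ, ∃ T : ℝ, (t : EReal) < a → t < T ∧ (T : EReal) < a := fun t => by
    by_cases ht : (t : EReal) < a
    · exact hTex t ht
    · exact ⟨0, fun h => absurd h ht⟩
  choose τ hτ using hτ
  -- Since `τ t` lies strictly beyond `t`, the glued function agrees near `t` with the single
  -- solution `Y (τ t)`.
  refine ⟨fun t => Y (τ t) t, hY0 _, fun t h0 ht => ?_⟩
  have hT := hτ t ht
  refine (hY (τ t) (by linarith) hT.2 t ⟨h0, hT.1⟩).congr_of_eventuallyEq ?_ rfl
  filter_upwards [self_mem_nhdsWithin, mem_nhdsWithin_of_mem_nhds (gt_mem_nhds hT.1)] with s hs hs'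
  have hsa : (s : EReal) < a := (EReal.coe_lt_coe_iff.2 hs').trans hT.2
  exact huniq _ _ (hτ s hsa).2 hT.2 s hs (hτ s hsa).1 hs'

/-- Differentiation of the solution of a linear equation with respect to a parameter: the
derivative is the solution `S` of the linearized equation. -/
theorem hasDerivWithinAt_linearODE_param {𝕜 : Type*} [RCLike 𝕜] {E : Type*} [NormedRing E]
    [NormedAlgebra ℝ E] [NormedAlgebra 𝕜 E] {s : Set 𝕜} {p₀ : 𝕜} (hp₀ : p₀ ∈ s)
    {A : 𝕜 → ℝ → E} {A' : ℝ → E} {y : 𝕜 → ℝ → E} {S : ℝ → E} {T : ℝ} (hT : 0 ≤ T)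
    (hA₀ : ContinuousOn (A p₀) (Icc 0 T)) (hA' : ContinuousOn A' (Icc 0 T))
    (hdiff : ∀ ε > 0, ∀ᶠ p in 𝓝[s] p₀, ∀ t ∈ Icc 0 T,
      ‖A p t - A p₀ t - (p - p₀) • A' t‖ ≤ ε * ‖p - p₀‖)
    (hy : ∀ p ∈ s, ∀ t ∈ Icc 0 T, HasDerivWithinAt (y p) (A p t * y p t) (Ici 0) t)
    (hy0 : ∀ p ∈ s, y p 0 = y p₀ 0)
    (hS : ∀ t ∈ Icc 0 T,
      HasDerivWithinAt S (A p₀ t * S t + A' t * y p₀ t) (Ici 0) t) (hS0 : S 0 = 0) :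
    HasDerivWithinAt (fun p => y p T) (S T) s p₀ := by
  have hcy : ContinuousOn (y p₀) (Icc 0 T) := fun t ht =>
    (hy p₀ hp₀ t ht).continuousWithinAt.mono Icc_subset_Ici_self
  have hcS : ContinuousOn S (Icc 0 T) := fun t ht =>
    (hS t ht).continuousWithinAt.mono Icc_subset_Ici_self
  obtain ⟨KA, hKA⟩ := isCompact_Icc.exists_bound_of_continuousOn hA₀
  obtain ⟨KA', hKA'⟩ := isCompact_Icc.exists_bound_of_continuousOn hA'
  obtain ⟨Ky, hKy⟩ := isCompact_Icc.exists_bound_of_continuousOn hcy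
  obtain ⟨KS, hKS⟩ := isCompact_Icc.exists_bound_of_continuousOn hcS
  have h0T : (0 : ℝ) ∈ Icc 0 T := ⟨le_rfl, hT⟩
  have nKA' : 0 ≤ KA' := (norm_nonneg _).trans (hKA' 0 h0T)
  have nKA : 0 ≤ KA := (norm_nonneg _).trans (hKA 0 h0T)
  have nKy : 0 ≤ Ky := (norm_nonneg _).trans (hKy 0 h0T)
  have nKS : 0 ≤ KS := (norm_nonneg _).trans (hKS 0 h0T)
  rw [hasDerivWithinAt_iff_isLittleO, Asymptotics.isLittleO_iff]
  intro c hc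
  -- This bounds `‖A p‖` once `‖p - p₀‖ ≤ ε < 1`. It is also nonzero, which makes the Grönwall bound
  -- visibly linear in the inhomogeneity.
  set K := KA + KA' + 1 with hK
  -- the Grönwall bound depends continuously on the inhomogeneity and vanishes with it
  have hlim : Tendsto (fun ε => gronwallBound 0 K ε T) (𝓝 0) (𝓝 0) := by
    have := (gronwallBound_continuous_ε 0 K T).tendsto 0
    rwa [gronwallBound_ε0_δ0] at this
  have hlin : ∀ ε r : ℝ, gronwallBound 0 K (ε * r) T = gronwallBound 0 K ε T * r := by
    intro ε r
    have : K ≠ 0 := by positivity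
    simp only [gronwallBound_of_K_ne_0 this]
    ring
  have hlim2 : Tendsto (fun ε : ℝ => ε * Ky + ε * KA' * KS + ε * ε * KS) (𝓝[>] 0) (𝓝 0) := by
    have : Continuous fun ε : ℝ => ε * Ky + ε * KA' * KS + ε * ε * KS := by fun_prop
    simpa using (this.tendsto 0).mono_left nhdsWithin_le_nhds
  obtain ⟨ε, ⟨hεc, hε1⟩, hε0⟩ := (((hlim.comp hlim2).eventually (gt_mem_nhds hc)).and
    ((gt_mem_nhds (show (0 : ℝ) < 1 by norm_num)).filter_mono nhdsWithin_le_nhds)).and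
      self_mem_nhdsWithin |>.exists
  have hε0 : 0 < ε := hε0
  have hnear : ∀ᶠ p in 𝓝[s] p₀, ‖p - p₀‖ ≤ ε := by
    refine mem_nhdsWithin_of_mem_nhds ?_
    filter_upwards [Metric.ball_mem_nhds p₀ hε0] with p hp
    rw [← dist_eq_norm]; exact hp.le
  filter_upwards [hdiff ε hε0, hnear, self_mem_nhdsWithin] with p hp hpε hps
  have hAd : ∀ t ∈ Icc 0 T, ‖A p t - A p₀ t‖ ≤ (ε + KA') * ‖p - p₀‖ := by
    intro t ht
    calc ‖A p t - A p₀ t‖ = ‖(A p t - A p₀ t - (p - p₀) • A' t) + (p - p₀) • A' t‖ := by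
          rw [sub_add_cancel]
      _ ≤ ε * ‖p - p₀‖ + ‖p - p₀‖ * KA' := by
          refine (norm_add_le _ _).trans (add_le_add (hp t ht) ?_)
          rw [norm_smul]
          exact mul_le_mul_of_nonneg_left (hKA' t ht) (norm_nonneg _)
      _ = _ := by ring
  have hAp : ∀ t ∈ Icc 0 T, ‖A p t‖ ≤ K := by
    intro t ht
    have h1 : ‖A p t‖ ≤ ‖A p t - A p₀ t‖ + ‖A p₀ t‖ := by
      simpa using norm_add_le (A p t - A p₀ t) (A p₀ t)
    have h2 := hAd t ht
    have h3 : (ε + KA') * ‖p - p₀‖ ≤ (1 + KA') * 1 := by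
      gcongr
      exact hpε.trans hε1.le
    linarith [hKA t ht]
  -- The first-order remainder vanishes at `0` and solves the equation with coefficient `A p`, up to
  -- an inhomogeneity of size `o(‖p - p₀‖)`; Grönwall then finishes.
  let D : ℝ → E := fun t => y p t - y p₀ t - (p - p₀) • S t
  have hD : ∀ t ∈ Icc 0 T, HasDerivWithinAt D
      (A p t * D t + ((A p t - A p₀ t - (p - p₀) • A' t) * y p₀ t
        + (p - p₀) • ((A p t - A p₀ t) * S t))) (Ici 0) t := by
    intro t ht
    have := ((hy p hps t ht).sub (hy p₀ hp₀ t ht)).sub ((hS t ht).const_smul (p - p₀))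
    refine this.congr_deriv ?_
    simp only [D, mul_sub, sub_mul, smul_add, smul_sub, mul_smul_comm, smul_mul_assoc]
    abel
  have hG := norm_le_gronwallBound_of_norm_deriv_right_le (f := D) (δ := 0) (K := K)
    (ε := (ε * Ky + ε * KA' * KS + ε * ε * KS) * ‖p - p₀‖) (a := 0) (b := T)
    (fun t ht => (hD t ht).continuousWithinAt.mono Icc_subset_Ici_self)
    (fun t ht => (hD t (Ico_subset_Icc_self ht)).mono (Ici_subset_Ici.2 ht.1))
    (by simp [D, hS0, hy0 p hps]) (fun t ht => ?_) T ⟨hT, le_rfl⟩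
  · rw [sub_zero, hlin] at hG
    refine hG.trans ?_
    gcongr
    exact hεc.le
  · have ht' := Ico_subset_Icc_self ht
    have e1 : ‖A p t * D t‖ ≤ K * ‖D t‖ :=
      (norm_mul_le _ _).trans (mul_le_mul_of_nonneg_right (hAp t ht') (norm_nonneg _))
    have e2 : ‖(A p t - A p₀ t - (p - p₀) • A' t) * y p₀ t‖ ≤ ε * ‖p - p₀‖ * Ky :=
      (norm_mul_le _ _).trans (mul_le_mul (hp t ht') (hKy t ht') (norm_nonneg _) (by positivity))
    have e3 : ‖(p - p₀) • ((A p t - A p₀ t) * S t)‖ ≤ ε * ((ε + KA') * ‖p - p₀‖ * KS) := by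
      rw [norm_smul]
      refine mul_le_mul hpε ((norm_mul_le _ _).trans ?_) (norm_nonneg _) hε0.le
      exact mul_le_mul (hAd t ht') (hKS t ht') (norm_nonneg _) (by positivity)
    calc _ ≤ _ := norm_add_le _ _
      _ ≤ K * ‖D t‖ + (ε * ‖p - p₀‖ * Ky + ε * ((ε + KA') * ‖p - p₀‖ * KS)) :=
        add_le_add e1 ((norm_add_le _ _).trans (add_le_add e2 e3))
      _ = _ := by ring

/-- Holomorphic dependence of the solution of a linear equation on a complex parameter. -/
theorem differentiableAt_linearODE_param {E : Type*} [NormedRing E] [NormedAlgebra ℂ E]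
    [CompleteSpace E] {p₀ : ℂ} {A : ℂ → ℝ → E} {A' : ℝ → E} {y : ℂ → ℝ → E}
    {T : ℝ} (hT : 0 ≤ T)
    (hA₀ : ContinuousOn (A p₀) (Icc 0 T)) (hA' : ContinuousOn A' (Icc 0 T))
    (hdiff : ∀ ε > 0, ∀ᶠ p in 𝓝 p₀, ∀ t ∈ Icc 0 T,
      ‖A p t - A p₀ t - (p - p₀) • A' t‖ ≤ ε * ‖p - p₀‖)
    (hy : ∀ p, ∀ t ∈ Icc 0 T, HasDerivWithinAt (y p) (A p t * y p t) (Ici 0) t)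
    (hy0 : ∀ p, y p 0 = y p₀ 0) :
    DifferentiableAt ℂ (fun p => y p T) p₀ := by
  -- The equation and its linearization form one triangular linear system for the pair `(y, S)`, so
  -- existence theory also supplies the derivative `S`.
  let L : ℝ → (E × E) →L[ℝ] (E × E) := fun t =>
    ((ContinuousLinearMap.mul ℝ E (A p₀ t)).comp (ContinuousLinearMap.fst ℝ E E)).prod
      ((ContinuousLinearMap.mul ℝ E (A p₀ t)).comp (ContinuousLinearMap.snd ℝ E E) +
        (ContinuousLinearMap.mul ℝ E (A' t)).comp (ContinuousLinearMap.fst ℝ E E))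
  have hL : ContinuousOn L (Icc 0 T) := by
    have h1 : ContinuousOn (fun t => ContinuousLinearMap.mul ℝ E (A p₀ t)) (Icc 0 T) :=
      (ContinuousLinearMap.mul ℝ E).continuous.comp_continuousOn hA₀
    have h2 : ContinuousOn (fun t => ContinuousLinearMap.mul ℝ E (A' t)) (Icc 0 T) :=
      (ContinuousLinearMap.mul ℝ E).continuous.comp_continuousOn hA'
    have h3 : ContinuousOn (fun t => ((ContinuousLinearMap.mul ℝ E (A p₀ t)).comp
        (ContinuousLinearMap.fst ℝ E E), (ContinuousLinearMap.mul ℝ E (A p₀ t)).comp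
        (ContinuousLinearMap.snd ℝ E E) + (ContinuousLinearMap.mul ℝ E (A' t)).comp
        (ContinuousLinearMap.fst ℝ E E))) (Icc 0 T) :=
      (h1.clm_comp continuousOn_const).prodMk
        ((h1.clm_comp continuousOn_const).add (h2.clm_comp continuousOn_const))
    exact (ContinuousLinearMap.prodₗᵢ ℝ).continuous.comp_continuousOn h3
  obtain ⟨Y, hY0, hY⟩ := exists_linearODE_Icc hT hL (y p₀ 0, (0 : E))
  have hY1 : ∀ t ∈ Icc 0 T, HasDerivWithinAt (fun s => (Y s).1) (A p₀ t * (Y t).1) (Ici 0) t :=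
    fun t ht => (ContinuousLinearMap.fst ℝ E E).hasFDerivAt.comp_hasDerivWithinAt t (hY t ht)
  have hY2 : ∀ t ∈ Icc 0 T, HasDerivWithinAt (fun s => (Y s).2)
      (A p₀ t * (Y t).2 + A' t * (Y t).1) (Ici 0) t :=
    fun t ht => (ContinuousLinearMap.snd ℝ E E).hasFDerivAt.comp_hasDerivWithinAt t (hY t ht)
  have heq : ∀ t ∈ Icc 0 T, (Y t).1 = y p₀ t :=
    linearODE_unique (A := fun t => ContinuousLinearMap.mul ℝ E (A p₀ t))
      ((ContinuousLinearMap.mul ℝ E).continuous.comp_continuousOn hA₀) hY1 (hy p₀) (by rw [hY0])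
  have := hasDerivWithinAt_linearODE_param (s := univ) (p₀ := p₀) (mem_univ _) hT hA₀ hA'
    (by simpa using hdiff) (fun p _ => hy p) (fun p _ => hy0 p)
    (fun t ht => by simpa only [heq t ht] using hY2 t ht) (by rw [hY0])
  exact (hasDerivWithinAt_univ.1 this).differentiableAt

/-- A function with a jointly continuous partial derivative is differentiable in the first
variable, uniformly in the second variable on compact intervals. -/
theorem eventually_norm_sub_sub_le {f f' : ℝ → ℝ → X} {T : ℝ}
    (hf' : ContinuousOn (Function.uncurry f') (Ici 0 ×ˢ Icc 0 T))
    (hf : ∀ t ∈ Icc 0 T, ∀ x, 0 ≤ x → HasDerivWithinAt (fun y => f y t) (f' x t) (Ici 0) x)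
    {x₀ : ℝ} (hx₀ : 0 ≤ x₀) {ε : ℝ} (hε : 0 < ε) :
    ∀ᶠ p in 𝓝[Ici 0] x₀, ∀ t ∈ Icc 0 T,
      ‖f p t - f x₀ t - (p - x₀) • f' x₀ t‖ ≤ ε * ‖p - x₀‖ := by
  -- Compactness in `t` gives one neighbourhood of `x₀` on which `f'` varies by less than `ε`; the
  -- mean value inequality is then applied to the remainder.
  obtain ⟨v, hv, hvε⟩ := isCompact_Icc.mem_uniformity_of_prod hf' (show x₀ ∈ Ici 0 from hx₀)
    (Metric.dist_mem_uniformity hε)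
  obtain ⟨δ, hδ, hδv⟩ := Metric.mem_nhdsWithin_iff.1 hv
  have hnear : Metric.ball x₀ δ ∩ Ici 0 ∈ 𝓝[Ici 0] x₀ :=
    inter_mem (mem_nhdsWithin_of_mem_nhds (Metric.ball_mem_nhds _ hδ)) self_mem_nhdsWithin
  filter_upwards [hnear] with p hp t ht
  have key := ((convex_ball x₀ δ).inter (convex_Ici (0 : ℝ))).norm_image_sub_le_of_norm_hasDerivWithin_le
    (f := fun y => f y t - (y - x₀) • f' x₀ t) (f' := fun y => f' y t - f' x₀ t) (C := ε)
    (fun y hy => ?_) (fun y hy => ?_) ⟨Metric.mem_ball_self hδ, hx₀⟩ hp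
  · convert key using 2
    simp only [sub_self, zero_smul, sub_zero]
    abel
  · have h1 := (hf t ht y hy.2).fun_sub
      (((hasDerivAt_id y).sub_const x₀).smul_const (f' x₀ t)).hasDerivWithinAt
    simpa using h1.mono inter_subset_right
  · have := hvε y (hδv hy) t ht
    rw [← dist_eq_norm]
    exact this.le

end LinearODE

/-! ### Zero curvature and the `j`-symmetry of the coefficients. -/

section Algebra

variable {m₁ m₂ : ℕ}

theorem jMat_mul_jMat : jMat m₁ m₂ * jMat m₁ m₂ = 1 := by
  simp [jMat, Matrix.fromBlocks_multiply]

theorem jMat_conjTranspose : (jMat m₁ m₂)ᴴ = jMat m₁ m₂ := by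
  simp [jMat, Matrix.fromBlocks_conjTranspose]

theorem potential_conjTranspose (w : Matrix (Fin m₁) (Fin m₂) ℂ) :
    (potential w)ᴴ = potential w := by
  simp [potential, Matrix.fromBlocks_conjTranspose]

theorem potential_mul_jMat (w : Matrix (Fin m₁) (Fin m₂) ℂ) :
    potential w * jMat m₁ m₂ = -(jMat m₁ m₂ * potential w) := by
  simp [jMat, potential, Matrix.fromBlocks_multiply, Matrix.fromBlocks_neg]

/-- The `x`-derivative of `F`. -/
noncomputable def coeffFx (w wx wxx : Matrix (Fin m₁) (Fin m₂) ℂ) (z : ℂ) :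
    Matrix (Fin m₁ ⊕ Fin m₂) (Fin m₁ ⊕ Fin m₂) ℂ :=
  -Complex.I • (z • (jMat m₁ m₂ * potential wx)
    - (1 / 2 : ℂ) • (Complex.I • potential wxx - jMat m₁ m₂ *
        (potential wx * potential w + potential w * potential wx)))

/-- The lower block of `V` evolves by the adjoint equation, where `i` changes sign; the factor `j`
accounts for this. -/
theorem potential_dnls {w wt wxx : Matrix (Fin m₁) (Fin m₂) ℂ}
    (h : (2 : ℂ) • wt = Complex.I • (wxx - (2 : ℂ) • (w * wᴴ * w))) :
    potential wt = (Complex.I / 2) • (jMat m₁ m₂ *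
      (potential wxx - (2 : ℂ) • (potential w * potential w * potential w))) := by
  have h1 : wt = (Complex.I / 2) • (wxx - (2 : ℂ) • (w * wᴴ * w)) := by
    rw [← inv_smul_smul₀ (two_ne_zero (α := ℂ)) wt, h, smul_smul]
    congr 1
    ring
  subst h1
  simp only [potential, jMat, Matrix.fromBlocks_multiply, Matrix.fromBlocks_smul,
    sub_eq_add_neg, Matrix.fromBlocks_neg, Matrix.fromBlocks_add]
  congr 1 <;> simp [Matrix.conjTranspose_smul, Matrix.mul_assoc, neg_div]
  abel

/-- The zero curvature equation. -/
theorem zero_curvature {w wx wt wxx : Matrix (Fin m₁) (Fin m₂) ℂ} (z : ℂ)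
    (h : (2 : ℂ) • wt = Complex.I • (wxx - (2 : ℂ) • (w * wᴴ * w))) :
    Complex.I • (jMat m₁ m₂ * potential wt) + coeffG w z * coeffF w wx z =
      coeffFx w wx wxx z + coeffF w wx z * coeffG w z := by
  rw [potential_dnls h]
  unfold coeffG coeffF coeffFx
  have hJ := jMat_mul_jMat (m₁ := m₁) (m₂ := m₂)
  have hV := potential_mul_jMat w
  have hX := potential_mul_jMat wx
  -- Only `J² = 1` and the anticommutation of `J` with `V` and `V_x` matter from here. Moving every
  -- `J` to the left gives a normal form whose coefficients can be compared.
  generalize potential w = V at *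
  generalize potential wx = X at *
  generalize potential wxx = Y at *
  generalize jMat m₁ m₂ = J at *
  have hJ' : ∀ B, J * (J * B) = B := fun B => by rw [← mul_assoc, hJ, one_mul]
  have hV' : ∀ B, V * (J * B) = -(J * (V * B)) := fun B => by
    rw [← mul_assoc, hV, neg_mul, mul_assoc]
  have hX' : ∀ B, X * (J * B) = -(J * (X * B)) := fun B => by
    rw [← mul_assoc, hX, neg_mul, mul_assoc]
  simp only [pow_two, mul_add, add_mul, mul_sub, sub_mul, smul_mul_assoc, mul_smul_comm, mul_assoc,
    hJ, hJ', hV, hV', hX, hX', mul_neg, neg_mul, smul_add, smul_sub, smul_neg, neg_smul,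
    smul_smul, neg_neg]
  match_scalars <;> ring_nf <;> simp <;> ring

/-- `j (jV) = V` is Hermitian and cancels against its adjoint after multiplication by `i`. Hence the
form decreases in `x` on `ℂ₊`, for any potential. -/
theorem coeffG_jMat (w : Matrix (Fin m₁) (Fin m₂) ℂ) (z : ℂ) :
    (coeffG w z)ᴴ * jMat m₁ m₂ + jMat m₁ m₂ * coeffG w z
      = ((-2 * z.im : ℝ) : ℂ) • (1 : Matrix (Fin m₁ ⊕ Fin m₂) (Fin m₁ ⊕ Fin m₂) ℂ) := by
  unfold coeffG
  simp only [Matrix.conjTranspose_smul, Matrix.conjTranspose_add, Matrix.conjTranspose_mul,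
    jMat_conjTranspose, potential_conjTranspose, smul_mul_assoc, mul_smul_comm, add_mul, mul_add,
    mul_assoc, jMat_mul_jMat, ← mul_assoc (jMat m₁ m₂) (jMat m₁ m₂), one_mul, mul_one]
  match_scalars
  · apply Complex.ext <;> (simp; try ring)
  · simp

/-- The terms in `V_x` and `V²` cancel. The right side is nonnegative for `Im z > 0` and `2 Re z ≥
‖V‖`, which is why no bound on `v_x` is required. -/
theorem coeffF_jMat (w wx : Matrix (Fin m₁) (Fin m₂) ℂ) (z : ℂ) :
    (coeffF w wx z)ᴴ * jMat m₁ m₂ + jMat m₁ m₂ * coeffF w wx z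
      = ((2 * z.im : ℝ) : ℂ) • (((2 * z.re : ℝ) : ℂ) • 1 + potential w) := by
  unfold coeffF
  have hX := potential_mul_jMat wx
  simp only [Matrix.conjTranspose_smul, Matrix.conjTranspose_add, Matrix.conjTranspose_sub,
    Matrix.conjTranspose_mul, Matrix.conjTranspose_pow,
    jMat_conjTranspose, potential_conjTranspose, smul_mul_assoc, mul_smul_comm, add_mul, mul_add,
    sub_mul, mul_sub,
    mul_assoc, jMat_mul_jMat, ← mul_assoc (jMat m₁ m₂) (jMat m₁ m₂), one_mul, mul_one, hX]
  match_scalars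
  all_goals (try apply Complex.ext) <;> simp [pow_two] <;> ring

theorem coeffG_sub (w : Matrix (Fin m₁) (Fin m₂) ℂ) (z z₀ : ℂ) :
    coeffG w z - coeffG w z₀ - (z - z₀) • (Complex.I • jMat m₁ m₂) = 0 := by
  unfold coeffG; module

theorem coeffF_sub (w wx : Matrix (Fin m₁) (Fin m₂) ℂ) (z z₀ : ℂ) :
    coeffF w wx z - coeffF w wx z₀ - (z - z₀) •
      (-Complex.I • ((2 * z₀) • jMat m₁ m₂ + jMat m₁ m₂ * potential w))
      = ((z - z₀) ^ 2) • (-Complex.I • jMat m₁ m₂) := by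
  unfold coeffF; module

end Algebra

/-! ### Regularity of `v`, and the factorization produced by zero curvature. -/

section Regularity

variable {m₁ m₂ : ℕ}

theorem semistrip_eq (a : EReal) : semistrip a = Ici 0 ×ˢ {t : ℝ | 0 ≤ t ∧ (t : EReal) < a} := by
  ext p; simp [semistrip]

theorem continuousOn_slice_fst {E : Type*} [TopologicalSpace E] {a : EReal} {g : ℝ → ℝ → E}
    (h : ContinuousOn (fun p : ℝ × ℝ => g p.1 p.2) (semistrip a)) {t : ℝ} (ht : 0 ≤ t)
    (hta : (t : EReal) < a) : ContinuousOn (fun x => g x t) (Ici 0) :=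
  ContinuousOn.comp (f := fun x : ℝ => (x, t)) h (by fun_prop) fun _ hx => ⟨hx, ht, hta⟩

theorem continuousOn_slice_snd {E : Type*} [TopologicalSpace E] {a : EReal} {g : ℝ → ℝ → E}
    (h : ContinuousOn (fun p : ℝ × ℝ => g p.1 p.2) (semistrip a)) {x : ℝ} (hx : 0 ≤ x) :
    ContinuousOn (fun t => g x t) {t : ℝ | 0 ≤ t ∧ (t : EReal) < a} :=
  ContinuousOn.comp (f := fun t : ℝ => (x, t)) h (by fun_prop) fun _ ht => ⟨hx, ht⟩

theorem mem_nhdsWithin_timeInterval {a : EReal} {t : ℝ} (ht : (t : EReal) < a) :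
    {s : ℝ | 0 ≤ s ∧ (s : EReal) < a} ∈ 𝓝[Ici 0] t := by
  obtain ⟨T, h1, h2⟩ := EReal.lt_iff_exists_real_btwn.1 ht
  filter_upwards [self_mem_nhdsWithin,
    mem_nhdsWithin_of_mem_nhds (gt_mem_nhds (EReal.coe_lt_coe_iff.1 h1))] with s hs hs'
  exact ⟨hs, (EReal.coe_lt_coe_iff.2 hs').trans h2⟩

theorem uniqueDiffOn_semistrip (a : EReal) : UniqueDiffOn ℝ (semistrip a) := by
  rw [semistrip_eq]
  refine (uniqueDiffOn_Ici 0).prod fun t ht => ?_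
  exact ((uniqueDiffOn_Ici (0 : ℝ)) t ht.1).mono_nhds
    (nhdsWithin_le_iff.2 (mem_nhdsWithin_timeInterval ht.2))

variable {a : EReal} {v : ℝ → ℝ → Matrix (Fin m₁) (Fin m₂) ℂ}

theorem hasDerivWithinAt_partialX
    (hC1 : ContDiffOn ℝ 1 (fun p : ℝ × ℝ => v p.1 p.2) (semistrip a)) {x t : ℝ}
    (h : (x, t) ∈ semistrip a) :
    HasDerivWithinAt (fun y => v y t)
      (fderivWithin ℝ (fun p : ℝ × ℝ => v p.1 p.2) (semistrip a) (x, t) (1, 0)) (Ici 0) x := by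
  have h1 := (hC1.differentiableOn one_ne_zero (x, t) h).hasFDerivWithinAt
  have h2 : HasDerivWithinAt (fun y : ℝ => (y, t)) ((1 : ℝ), (0 : ℝ)) (Ici 0) x :=
    ((hasDerivAt_id x).prodMk (hasDerivAt_const x t)).hasDerivWithinAt
  have h3 : MapsTo (fun y : ℝ => (y, t)) (Ici 0) (semistrip a) := fun y hy => ⟨hy, h.2⟩
  exact h1.comp_hasDerivWithinAt x h2 h3

theorem hasDerivWithinAt_partialT
    (hC1 : ContDiffOn ℝ 1 (fun p : ℝ × ℝ => v p.1 p.2) (semistrip a)) {x t : ℝ}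
    (h : (x, t) ∈ semistrip a) :
    HasDerivWithinAt (fun s => v x s)
      (fderivWithin ℝ (fun p : ℝ × ℝ => v p.1 p.2) (semistrip a) (x, t) (0, 1)) (Ici 0) t := by
  have h1 := (hC1.differentiableOn one_ne_zero (x, t) h).hasFDerivWithinAt
  have h2 : HasDerivWithinAt (fun s : ℝ => (x, s)) ((0 : ℝ), (1 : ℝ))
      {s : ℝ | 0 ≤ s ∧ (s : EReal) < a} t :=
    ((hasDerivAt_const t x).prodMk (hasDerivAt_id t)).hasDerivWithinAt
  have h3 : MapsTo (fun s : ℝ => (x, s)) {s : ℝ | 0 ≤ s ∧ (s : EReal) < a} (semistrip a) :=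
    fun s hs => ⟨h.1, hs⟩
  exact (h1.comp_hasDerivWithinAt t h2 h3).mono_of_mem_nhdsWithin
    (mem_nhdsWithin_timeInterval h.2.2)

theorem partialX_eq (hC1 : ContDiffOn ℝ 1 (fun p : ℝ × ℝ => v p.1 p.2) (semistrip a)) {x t : ℝ}
    (h : (x, t) ∈ semistrip a) : partialX v x t =
      fderivWithin ℝ (fun p : ℝ × ℝ => v p.1 p.2) (semistrip a) (x, t) (1, 0) :=
  (hasDerivWithinAt_partialX hC1 h).derivWithin (uniqueDiffOn_Ici 0 x h.1)

theorem partialT_eq (hC1 : ContDiffOn ℝ 1 (fun p : ℝ × ℝ => v p.1 p.2) (semistrip a)) {x t : ℝ}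
    (h : (x, t) ∈ semistrip a) : partialT v x t =
      fderivWithin ℝ (fun p : ℝ × ℝ => v p.1 p.2) (semistrip a) (x, t) (0, 1) :=
  (hasDerivWithinAt_partialT hC1 h).derivWithin (uniqueDiffOn_Ici 0 t h.2.1)

theorem continuousOn_partialX
    (hC1 : ContDiffOn ℝ 1 (fun p : ℝ × ℝ => v p.1 p.2) (semistrip a)) :
    ContinuousOn (fun p : ℝ × ℝ => partialX v p.1 p.2) (semistrip a) :=
  ((hC1.continuousOn_fderivWithin (uniqueDiffOn_semistrip a) le_rfl).clm_apply
    continuousOn_const).congr fun _ hp => partialX_eq hC1 hp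

theorem continuousOn_partialT
    (hC1 : ContDiffOn ℝ 1 (fun p : ℝ × ℝ => v p.1 p.2) (semistrip a)) :
    ContinuousOn (fun p : ℝ × ℝ => partialT v p.1 p.2) (semistrip a) :=
  ((hC1.continuousOn_fderivWithin (uniqueDiffOn_semistrip a) le_rfl).clm_apply
    continuousOn_const).congr fun _ hp => partialT_eq hC1 hp

/-- Mere existence of `v_xx` is assumed; the differential equation expresses it through the
continuous functions `v_t` and `v`. -/
theorem continuousOn_partialXX
    (hC1 : ContDiffOn ℝ 1 (fun p : ℝ × ℝ => v p.1 p.2) (semistrip a))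
    (hNLS : SolvesDNLS a v) :
    ContinuousOn (fun p : ℝ × ℝ => partialXX v p.1 p.2) (semistrip a) := by
  have hcub : Continuous fun w : Matrix (Fin m₁) (Fin m₂) ℂ => w * wᴴ * w :=
    (continuous_id.matrix_mul continuous_id.matrix_conjTranspose).matrix_mul continuous_id
  have hm : ContinuousOn (fun p : ℝ × ℝ => v p.1 p.2 * (v p.1 p.2)ᴴ * v p.1 p.2)
      (semistrip a) :=
    hcub.comp_continuousOn (f := fun p : ℝ × ℝ => v p.1 p.2) hC1.continuousOn
  refine (((continuousOn_partialT hC1).const_smul (-2 * Complex.I)).add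
    (hm.const_smul (2 : ℂ))).congr fun p hp => ?_
  have h := (hNLS p.1 p.2 hp).2
  have h2 : (-2 * Complex.I) • partialT v p.1 p.2 =
      partialXX v p.1 p.2 - (2 : ℂ) • (v p.1 p.2 * (v p.1 p.2)ᴴ * v p.1 p.2) := by
    rw [show -2 * Complex.I = -Complex.I * 2 by ring, mul_smul, h, smul_smul]
    simp
  change partialXX v p.1 p.2 = (-2 * Complex.I) • partialT v p.1 p.2 +
    (2 : ℂ) • (v p.1 p.2 * (v p.1 p.2)ᴴ * v p.1 p.2)
  rw [h2, sub_add_cancel]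

/-- `potential` as a real continuous linear map. -/
noncomputable def potentialCLM (m₁ m₂ : ℕ) : Matrix (Fin m₁) (Fin m₂) ℂ →L[ℝ]
    Matrix (Fin m₁ ⊕ Fin m₂) (Fin m₁ ⊕ Fin m₂) ℂ :=
  LinearMap.toContinuousLinearMap
    { toFun := potential
      map_add' := fun x y => by simp [potential, Matrix.fromBlocks_add]
      map_smul' := fun c x => by
        simp [potential, Matrix.fromBlocks_smul, Matrix.conjTranspose_smul] }

theorem continuous_potential : Continuous (potential (m₁ := m₁) (m₂ := m₂)) :=
  (potentialCLM m₁ m₂).continuous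

theorem continuous_coeffG (z : ℂ) : Continuous fun w : Matrix (Fin m₁) (Fin m₂) ℂ =>
    coeffG w z := by
  have := continuous_potential (m₁ := m₁) (m₂ := m₂)
  unfold coeffG
  fun_prop

theorem continuous_coeffF (z : ℂ) :
    Continuous fun p : Matrix (Fin m₁) (Fin m₂) ℂ × Matrix (Fin m₁) (Fin m₂) ℂ =>
      coeffF p.1 p.2 z := by
  have h := continuous_potential (m₁ := m₁) (m₂ := m₂)
  have h1 := h.comp (continuous_fst (X := Matrix (Fin m₁) (Fin m₂) ℂ)
    (Y := Matrix (Fin m₁) (Fin m₂) ℂ))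
  have h2 := h.comp (continuous_snd (X := Matrix (Fin m₁) (Fin m₂) ℂ)
    (Y := Matrix (Fin m₁) (Fin m₂) ℂ))
  simp only [Function.comp_def] at h1 h2
  unfold coeffF
  fun_prop

theorem continuous_coeffFx (z : ℂ) :
    Continuous fun p : Matrix (Fin m₁) (Fin m₂) ℂ × Matrix (Fin m₁) (Fin m₂) ℂ ×
      Matrix (Fin m₁) (Fin m₂) ℂ => coeffFx p.1 p.2.1 p.2.2 z := by
  have h := continuous_potential (m₁ := m₁) (m₂ := m₂)
  have h1 : Continuous fun p : Matrix (Fin m₁) (Fin m₂) ℂ × Matrix (Fin m₁) (Fin m₂) ℂ ×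
      Matrix (Fin m₁) (Fin m₂) ℂ => potential p.1 := h.comp continuous_fst
  have h2 : Continuous fun p : Matrix (Fin m₁) (Fin m₂) ℂ × Matrix (Fin m₁) (Fin m₂) ℂ ×
      Matrix (Fin m₁) (Fin m₂) ℂ => potential p.2.1 :=
    h.comp (continuous_fst.comp continuous_snd)
  have h3 : Continuous fun p : Matrix (Fin m₁) (Fin m₂) ℂ × Matrix (Fin m₁) (Fin m₂) ℂ ×
      Matrix (Fin m₁) (Fin m₂) ℂ => potential p.2.2 :=
    h.comp (continuous_snd.comp continuous_snd)
  unfold coeffFx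
  fun_prop

theorem hasDerivWithinAt_coeffG {w : ℝ → Matrix (Fin m₁) (Fin m₂) ℂ}
    {w' : Matrix (Fin m₁) (Fin m₂) ℂ} {s : Set ℝ} {x : ℝ} (h : HasDerivWithinAt w w' s x) (z : ℂ) :
    HasDerivWithinAt (fun x => coeffG (w x) z) (Complex.I • (jMat m₁ m₂ * potential w')) s x := by
  have hp : HasDerivWithinAt (fun x => potential (w x)) (potential w') s x :=
    (potentialCLM m₁ m₂).hasFDerivAt.comp_hasDerivWithinAt x h
  exact ((hp.const_mul (jMat m₁ m₂)).const_add (z • jMat m₁ m₂)).const_smul Complex.I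

theorem hasDerivWithinAt_coeffF {w wx : ℝ → Matrix (Fin m₁) (Fin m₂) ℂ}
    {wxx : Matrix (Fin m₁) (Fin m₂) ℂ} {s : Set ℝ} {x : ℝ} (h : HasDerivWithinAt w (wx x) s x)
    (hx : HasDerivWithinAt wx wxx s x) (z : ℂ) :
    HasDerivWithinAt (fun x => coeffF (w x) (wx x) z) (coeffFx (w x) (wx x) wxx z) s x := by
  have hp : HasDerivWithinAt (fun x => potential (w x)) (potential (wx x)) s x :=
    (potentialCLM m₁ m₂).hasFDerivAt.comp_hasDerivWithinAt x h
  have hpx : HasDerivWithinAt (fun x => potential (wx x)) (potential wxx) s x :=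
    (potentialCLM m₁ m₂).hasFDerivAt.comp_hasDerivWithinAt x hx
  have h1 := ((((hp.const_mul (jMat m₁ m₂)).const_smul z).const_add
    (z ^ 2 • jMat m₁ m₂)).fun_sub (((hpx.const_smul Complex.I).fun_sub
      ((hp.fun_mul hp).const_mul (jMat m₁ m₂))).const_smul (1 / 2 : ℂ))).const_smul (-Complex.I)
  simp only [coeffF, coeffFx, pow_two (potential _)]
  exact h1

theorem continuousOn_mulLeft {A : ℝ → Matrix (Fin m₁ ⊕ Fin m₂) (Fin m₁ ⊕ Fin m₂) ℂ} {s : Set ℝ}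
    (hA : ContinuousOn A s) : ContinuousOn (fun t => ContinuousLinearMap.mul ℝ
      (Matrix (Fin m₁ ⊕ Fin m₂) (Fin m₁ ⊕ Fin m₂) ℂ) (A t)) s :=
  (ContinuousLinearMap.mul ℝ _).continuous.comp_continuousOn hA

/-- Uniqueness for matrix linear equations. -/
theorem matrixODE_unique {A y y' : ℝ → Matrix (Fin m₁ ⊕ Fin m₂) (Fin m₁ ⊕ Fin m₂) ℂ} {T : ℝ}
    (hA : ContinuousOn A (Icc 0 T))
    (hy : ∀ t ∈ Icc 0 T, HasDerivWithinAt y (A t * y t) (Ici 0) t)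
    (hy' : ∀ t ∈ Icc 0 T, HasDerivWithinAt y' (A t * y' t) (Ici 0) t) (h0 : y 0 = y' 0) :
    ∀ t ∈ Icc 0 T, y t = y' t :=
  linearODE_unique (continuousOn_mulLeft hA) hy hy' h0

theorem exists_isFundamentalSolution {w : ℝ → Matrix (Fin m₁) (Fin m₂) ℂ}
    (hw : ContinuousOn w (Ici 0)) (z : ℂ) : ∃ u, IsFundamentalSolution w z u := by
  obtain ⟨u, h0, hu⟩ := exists_linearODE ⊤ (A := fun x => ContinuousLinearMap.mul ℝ
      (Matrix (Fin m₁ ⊕ Fin m₂) (Fin m₁ ⊕ Fin m₂) ℂ) (coeffG (w x) z))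
    (continuousOn_mulLeft ((continuous_coeffG z).comp_continuousOn (hw.mono fun t ht => ht.1))) 1
  exact ⟨u, h0, fun x hx => hu x hx (EReal.coe_lt_top x)⟩

theorem IsFundamentalSolution.eq {w : ℝ → Matrix (Fin m₁) (Fin m₂) ℂ}
    (hw : ContinuousOn w (Ici 0)) {z : ℂ}
    {u u' : ℝ → Matrix (Fin m₁ ⊕ Fin m₂) (Fin m₁ ⊕ Fin m₂) ℂ} (hu : IsFundamentalSolution w z u)
    (hu' : IsFundamentalSolution w z u') {x : ℝ} (hx : 0 ≤ x) : u x = u' x :=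
  matrixODE_unique (A := fun x => coeffG (w x) z)
    ((continuous_coeffG z).comp_continuousOn (hw.mono Icc_subset_Ici_self))
    (fun t ht => hu.2 t ht.1) (fun t ht => hu'.2 t ht.1) (hu.1.trans hu'.1.symm) x ⟨hx, le_rfl⟩

theorem continuousOn_coeffF_time
    (hC1 : ContDiffOn ℝ 1 (fun p : ℝ × ℝ => v p.1 p.2) (semistrip a)) {x : ℝ} (hx : 0 ≤ x)
    (z : ℂ) : ContinuousOn (fun t => coeffF (v x t) (partialX v x t) z)
      {t : ℝ | 0 ≤ t ∧ (t : EReal) < a} := by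
  exact (continuous_coeffF z).comp_continuousOn (f := fun t => (v x t, partialX v x t))
    ((continuousOn_slice_snd hC1.continuousOn hx).prodMk
      (continuousOn_slice_snd (continuousOn_partialX hC1) hx))

theorem continuousOn_coeffFx
    (hC1 : ContDiffOn ℝ 1 (fun p : ℝ × ℝ => v p.1 p.2) (semistrip a))
    (hNLS : SolvesDNLS a v) (z : ℂ) : ContinuousOn (fun p : ℝ × ℝ =>
      coeffFx (v p.1 p.2) (partialX v p.1 p.2) (partialXX v p.1 p.2) z) (semistrip a) :=
  (continuous_coeffFx z).comp_continuousOn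
    (f := fun p : ℝ × ℝ => (v p.1 p.2, partialX v p.1 p.2, partialXX v p.1 p.2))
    (hC1.continuousOn.prodMk
      ((continuousOn_partialX hC1).prodMk (continuousOn_partialXX hC1 hNLS)))

theorem exists_isTimeEvolution
    (hC1 : ContDiffOn ℝ 1 (fun p : ℝ × ℝ => v p.1 p.2) (semistrip a)) :
    ∃ R, IsTimeEvolution a v R := by
  have : ∀ (x : ℝ) (z : ℂ), ∃ y : ℝ → Matrix (Fin m₁ ⊕ Fin m₂) (Fin m₁ ⊕ Fin m₂) ℂ, 0 ≤ x →
      y 0 = 1 ∧ ∀ t : ℝ, 0 ≤ t → (t : EReal) < a →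
        HasDerivWithinAt y (coeffF (v x t) (partialX v x t) z * y t) (Ici 0) t := by
    intro x z
    by_cases hx : 0 ≤ x
    · obtain ⟨y, h0, hy⟩ := exists_linearODE a (A := fun t => ContinuousLinearMap.mul ℝ
          (Matrix (Fin m₁ ⊕ Fin m₂) (Fin m₁ ⊕ Fin m₂) ℂ) (coeffF (v x t) (partialX v x t) z))
        (continuousOn_mulLeft (continuousOn_coeffF_time hC1 hx z)) 1
      exact ⟨y, fun _ => ⟨h0, hy⟩⟩
    · exact ⟨0, fun h => absurd h hx⟩
  choose y hy using this
  exact ⟨fun x t z => y x z t, fun x z hx => hy x z hx⟩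

theorem timeInterval_subset {a : EReal} {T : ℝ} (hT : (T : EReal) < a) :
    Icc 0 T ⊆ {t : ℝ | 0 ≤ t ∧ (t : EReal) < a} := fun _ ht =>
  ⟨ht.1, lt_of_le_of_lt (EReal.coe_le_coe_iff.2 ht.2) hT⟩

variable {R : ℝ → ℝ → ℂ → Matrix (Fin m₁ ⊕ Fin m₂) (Fin m₁ ⊕ Fin m₂) ℂ}

/-- `R_x = G(x,t) R - R G(x,0)`: the consequence of the zero curvature equation. -/
theorem hasDerivWithinAt_timeEvolution
    (hC1 : ContDiffOn ℝ 1 (fun p : ℝ × ℝ => v p.1 p.2) (semistrip a))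
    (hNLS : SolvesDNLS a v) (hR : IsTimeEvolution a v R) {x T : ℝ} (hx : 0 ≤ x) (hT : 0 ≤ T)
    (hTa : (T : EReal) < a) (z : ℂ) :
    HasDerivWithinAt (fun y => R y T z)
      (coeffG (v x T) z * R x T z - R x T z * coeffG (v x 0) z) (Ici 0) x := by
  have hsub : Ici (0 : ℝ) ×ˢ Icc 0 T ⊆ semistrip a := by
    rw [semistrip_eq]; exact prod_mono_right (timeInterval_subset hTa)
  have hmem : ∀ {y t : ℝ}, 0 ≤ y → t ∈ Icc 0 T → (y, t) ∈ semistrip a :=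
    fun hy ht => hsub ⟨hy, ht⟩
  have hFx := continuousOn_coeffFx hC1 hNLS z
  -- No mixed derivative of `R` is presupposed. The expected value `S = G(x,t) R - R G(x,0)` of
  -- `R_x` is shown to solve the linearized equation `S_t = F S + F_x R` with `S = 0` at `t = 0`.
  refine hasDerivWithinAt_linearODE_param (𝕜 := ℝ) (s := Ici 0)
    (A := fun x t => coeffF (v x t) (partialX v x t) z) (y := fun x t => R x t z)
    (A' := fun t => coeffFx (v x t) (partialX v x t) (partialXX v x t) z)
    (S := fun t => coeffG (v x t) z * R x t z - R x t z * coeffG (v x 0) z)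
    hx hT ((continuousOn_coeffF_time hC1 hx z).mono (timeInterval_subset hTa)) ?_ ?_
    (fun y hy t ht => (hR y z hy).2 t ht.1 (timeInterval_subset hTa ht).2)
    (fun y hy => by rw [(hR y z hy).1, (hR x z hx).1]) ?_ ?_
  · exact (continuousOn_slice_snd (g := fun x t =>
      coeffFx (v x t) (partialX v x t) (partialXX v x t) z) hFx hx).mono (timeInterval_subset hTa)
  · intro ε hε
    refine eventually_norm_sub_sub_le (f := fun x t => coeffF (v x t) (partialX v x t) z)
      (f' := fun x t => coeffFx (v x t) (partialX v x t) (partialXX v x t) z)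
      (hFx.mono hsub) (fun t ht y hy => ?_) hx hε
    refine hasDerivWithinAt_coeffF (w := fun y => v y t) (wx := fun y => partialX v y t) ?_ ?_ z
    · rw [partialX_eq hC1 (hmem hy ht)]
      exact hasDerivWithinAt_partialX hC1 (hmem hy ht)
    · exact (hNLS y t (hmem hy ht)).1.hasDerivWithinAt
  · intro t ht
    have hRt := (hR x z hx).2 t ht.1 (timeInterval_subset hTa ht).2
    have hGt := hasDerivWithinAt_coeffG (hasDerivWithinAt_partialT hC1 (hmem hx ht)) z
    rw [← partialT_eq hC1 (hmem hx ht)] at hGt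
    refine ((hGt.fun_mul hRt).fun_sub (hRt.mul_const (coeffG (v x 0) z))).congr_deriv ?_
    have hzc := zero_curvature (wx := partialX v x t) z (hNLS x t (hmem hx ht)).2
    have hzc' := congrArg (· * R x t z) hzc
    simp only [add_mul] at hzc'
    rw [mul_sub, ← mul_assoc (coeffF _ _ _), ← mul_assoc (coeffF _ _ _), ← mul_assoc (coeffG _ _),
      hzc']
    abel
  · simp [(hR x z hx).1]

/-- The factorization `u(x,t) R(0,t) = R(x,t) u(x,0)`. -/
theorem fundamentalSolution_mul_timeEvolution
    (hC1 : ContDiffOn ℝ 1 (fun p : ℝ × ℝ => v p.1 p.2) (semistrip a))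
    (hNLS : SolvesDNLS a v) (hR : IsTimeEvolution a v R) {x t : ℝ} (hx : 0 ≤ x) (ht : 0 ≤ t)
    (hta : (t : EReal) < a) {z : ℂ}
    {u₀ u : ℝ → Matrix (Fin m₁ ⊕ Fin m₂) (Fin m₁ ⊕ Fin m₂) ℂ}
    (hu₀ : IsFundamentalSolution (fun x => v x 0) z u₀)
    (hu : IsFundamentalSolution (fun x => v x t) z u) :
    u x * R 0 t z = R x t z * u₀ x := by
  have hc : ContinuousOn (fun x => v x t) (Icc 0 x) :=
    (continuousOn_slice_fst hC1.continuousOn ht hta).mono Icc_subset_Ici_self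
  -- Both sides solve `y_x = G(x,t) y` and equal `R(0,t)` at `x = 0`: the term `-R G(x,0)` in `R_x`
  -- cancels the derivative of `u₀`.
  refine matrixODE_unique (A := fun x => coeffG (v x t) z) (y := fun x => u x * R 0 t z)
    (y' := fun x => R x t z * u₀ x) ((continuous_coeffG z).comp_continuousOn hc)
    (fun y hy => ?_) (fun y hy => ?_) ?_ x ⟨hx, le_rfl⟩
  · exact ((hu.2 y hy.1).mul_const _).congr_deriv (mul_assoc _ _ _)
  · refine ((hasDerivWithinAt_timeEvolution hC1 hNLS hR hy.1 ht hta z).fun_mul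
      (hu₀.2 y hy.1)).congr_deriv ?_
    simp only [sub_mul, mul_assoc, sub_add_cancel]
  · simp [hu.1, hu₀.1]

/-- `R(x,t,z)` is entire in `z`. -/
theorem differentiable_timeEvolution
    (hC1 : ContDiffOn ℝ 1 (fun p : ℝ × ℝ => v p.1 p.2) (semistrip a))
    (hR : IsTimeEvolution a v R) {x t : ℝ} (hx : 0 ≤ x) (ht : 0 ≤ t) (hta : (t : EReal) < a) :
    Differentiable ℂ fun z => R x t z := by
  intro z₀
  have hc : ContinuousOn (fun t => v x t) (Icc 0 t) :=
    (continuousOn_slice_snd hC1.continuousOn hx).mono (timeInterval_subset hta)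
  refine differentiableAt_linearODE_param
    (A := fun z t => coeffF (v x t) (partialX v x t) z) (y := fun z t => R x t z)
    (A' := fun t => -Complex.I • ((2 * z₀) • jMat m₁ m₂ + jMat m₁ m₂ * potential (v x t))) ht
    ((continuousOn_coeffF_time hC1 hx z₀).mono (timeInterval_subset hta)) ?_ ?_
    (fun z s hs => (hR x z hx).2 s hs.1 (timeInterval_subset hta hs).2)
    (fun z => by rw [(hR x z hx).1, (hR x z₀ hx).1])
  · have := continuous_potential.comp_continuousOn hc
    simp only [Function.comp_def] at this
    fun_prop
  · intro ε hε
    have hlim : Tendsto (fun z => ‖z - z₀‖ * ‖-Complex.I • jMat m₁ m₂‖) (𝓝 z₀) (𝓝 0) := by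
      have : Continuous fun z => ‖z - z₀‖ * ‖-Complex.I • jMat m₁ m₂‖ := by fun_prop
      simpa using this.tendsto z₀
    filter_upwards [hlim.eventually (gt_mem_nhds hε)] with z hz s _
    rw [coeffF_sub, norm_smul, norm_pow, pow_two, mul_assoc, mul_comm]
    rw [mul_comm ε, mul_comm _ (‖z - z₀‖)]
    exact mul_le_mul_of_nonneg_left hz.le (norm_nonneg _)

/-- The fundamental solution of the Dirac system is entire in the spectral parameter. -/
theorem differentiable_fundamentalSolution {w : ℝ → Matrix (Fin m₁) (Fin m₂) ℂ}
    (hw : ContinuousOn w (Ici 0))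
    {u : ℂ → ℝ → Matrix (Fin m₁ ⊕ Fin m₂) (Fin m₁ ⊕ Fin m₂) ℂ}
    (hu : ∀ z, IsFundamentalSolution w z (u z)) {x : ℝ} (hx : 0 ≤ x) :
    Differentiable ℂ fun z => u z x := by
  intro z₀
  refine differentiableAt_linearODE_param (A := fun z x => coeffG (w x) z)
    (A' := fun _ => Complex.I • jMat m₁ m₂) hx
    ((continuous_coeffG z₀).comp_continuousOn (hw.mono Icc_subset_Ici_self))
    continuousOn_const ?_ (fun z s hs => (hu z).2 s hs.1)
    (fun z => by rw [(hu z).1, (hu z₀).1])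
  intro ε hε
  filter_upwards with z s _
  rw [coeffG_sub, norm_zero]
  positivity

end Regularity

/-! ### The indefinite form `y* j y` and conserved quantities. -/

section Forms

variable {m₁ m₂ : ℕ}

/-- The squared Euclidean norm of a complex vector. -/
noncomputable def normSqVec {ι : Type*} [Fintype ι] (y : ι → ℂ) : ℝ := ∑ i, ‖y i‖ ^ 2

/-- The indefinite form `y* j y`. -/
noncomputable def jForm (y : Fin m₁ ⊕ Fin m₂ → ℂ) : ℝ :=
  normSqVec (fun i => y (Sum.inl i)) - normSqVec (fun i => y (Sum.inr i))

theorem normSqVec_nonneg {ι : Type*} [Fintype ι] (y : ι → ℂ) : 0 ≤ normSqVec y :=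
  Finset.sum_nonneg fun _ _ => by positivity

theorem eq_zero_of_normSqVec_le {ι : Type*} [Fintype ι] {y : ι → ℂ} (h : normSqVec y ≤ 0) :
    y = 0 := by
  have h0 : normSqVec y = 0 := le_antisymm h (normSqVec_nonneg y)
  funext i
  have := (Finset.sum_eq_zero_iff_of_nonneg fun i _ => by positivity).1 h0 i (Finset.mem_univ i)
  simpa using this

@[simp] theorem normSqVec_zero {ι : Type*} [Fintype ι] : normSqVec (0 : ι → ℂ) = 0 := by
  simp [normSqVec]

theorem normSqVec_eq_norm {ι : Type*} [Fintype ι] (y : ι → ℂ) :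
    normSqVec y = ‖WithLp.toLp 2 y‖ ^ 2 := by
  rw [EuclideanSpace.norm_sq_eq]; rfl

theorem normSqVec_eq_dotProduct {ι : Type*} [Fintype ι] (y : ι → ℂ) :
    normSqVec y = (star y ⬝ᵥ y).re := by
  simp only [normSqVec, dotProduct, Complex.re_sum, Pi.star_apply]
  refine Finset.sum_congr rfl fun i _ => ?_
  rw [Complex.sq_norm, Complex.normSq_apply]
  simp

theorem jForm_eq_dotProduct (y : Fin m₁ ⊕ Fin m₂ → ℂ) :
    jForm y = (star y ⬝ᵥ (jMat m₁ m₂ *ᵥ y)).re := by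
  have hy : jMat m₁ m₂ *ᵥ y = Sum.elim (fun i => y (Sum.inl i)) (fun i => -y (Sum.inr i)) := by
    rw [jMat, Matrix.fromBlocks_mulVec]
    simp only [Matrix.one_mulVec, Matrix.zero_mulVec, add_zero, zero_add, Matrix.neg_mulVec]
    rfl
  rw [hy, jForm, normSqVec_eq_dotProduct, normSqVec_eq_dotProduct]
  simp [dotProduct, Fintype.sum_sum_type, sub_eq_add_neg]

theorem normSqVec_sum (y : Fin m₁ ⊕ Fin m₂ → ℂ) : normSqVec y =
    normSqVec (fun i => y (Sum.inl i)) + normSqVec (fun i => y (Sum.inr i)) := by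
  simp [normSqVec, Fintype.sum_sum_type]

theorem neg_jForm_le (y : Fin m₁ ⊕ Fin m₂ → ℂ) : -jForm y ≤ normSqVec y := by
  rw [normSqVec_sum, jForm]
  linarith [normSqVec_nonneg fun i => y (Sum.inl i)]

theorem jForm_elim (c : Fin m₁ → ℂ) (d : Fin m₂ → ℂ) :
    jForm (Sum.elim c d) = normSqVec c - normSqVec d := rfl

theorem normSqVec_parallelogram {ι : Type*} [Fintype ι] (y y' : ι → ℂ) :
    normSqVec (y - y') + normSqVec (y + y') = 2 * normSqVec y + 2 * normSqVec y' := by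
  simp only [normSqVec_eq_norm, WithLp.toLp_sub, WithLp.toLp_add]
  have := parallelogram_law_with_norm ℂ (WithLp.toLp 2 y) (WithLp.toLp 2 y')
  linarith

theorem jForm_parallelogram (y y' : Fin m₁ ⊕ Fin m₂ → ℂ) :
    jForm (y - y') + jForm (y + y') = 2 * jForm y + 2 * jForm y' := by
  have h1 := normSqVec_parallelogram (fun i => y (Sum.inl i)) (fun i => y' (Sum.inl i))
  have h2 := normSqVec_parallelogram (fun i => y (Sum.inr i)) (fun i => y' (Sum.inr i))
  simp only [jForm]
  simp only [Pi.sub_def, Pi.add_def] at h1 h2 ⊢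
  linarith

theorem continuous_jForm : Continuous (jForm (m₁ := m₁) (m₂ := m₂)) := by
  unfold jForm normSqVec; fun_prop

theorem abs_re_dotProduct_mulVec_le {ι : Type*} [Fintype ι] [DecidableEq ι] (A : Matrix ι ι ℂ)
    (y : ι → ℂ) : |(star y ⬝ᵥ (A *ᵥ y)).re| ≤ ‖A‖ * normSqVec y := by
  have h1 : star y ⬝ᵥ (A *ᵥ y) = inner ℂ (WithLp.toLp 2 y) (WithLp.toLp 2 (A *ᵥ y)) := by
    rw [EuclideanSpace.inner_toLp_toLp, dotProduct_comm]
  rw [h1]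
  refine (Complex.abs_re_le_norm _).trans ((norm_inner_le_norm _ _).trans ?_)
  have h2 := Matrix.l2_opNorm_mulVec A (WithLp.toLp 2 y)
  rw [normSqVec_eq_norm]
  calc _ ≤ ‖WithLp.toLp 2 y‖ * (‖A‖ * ‖WithLp.toLp 2 y‖) :=
        mul_le_mul_of_nonneg_left h2 (norm_nonneg _)
    _ = _ := by ring

theorem l2_opNorm_le_of_normSqVec {m n : ℕ} {C : Matrix (Fin m) (Fin n) ℂ} {r : ℝ} (hr : 0 ≤ r)
    (h : ∀ c, normSqVec (C *ᵥ c) ≤ r ^ 2 * normSqVec c) : ‖C‖ ≤ r := by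
  rw [Matrix.l2_opNorm_def]
  refine ContinuousLinearMap.opNorm_le_bound _ hr fun c => ?_
  refine abs_le_of_sq_le_sq' ?_ (by positivity) |>.2
  rw [mul_pow]
  have := h c.ofLp
  rw [normSqVec_eq_norm, normSqVec_eq_norm] at this
  exact this

/-- The real-linear functional `K ↦ Re (ξ* K ξ)`. -/
noncomputable def quadCLM {ι : Type*} [Fintype ι] [DecidableEq ι] (ξ : ι → ℂ) :
    Matrix ι ι ℂ →L[ℝ] ℝ :=
  LinearMap.toContinuousLinearMap
    { toFun := fun K => (star ξ ⬝ᵥ (K *ᵥ ξ)).re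
      map_add' := fun x y => by simp [Matrix.add_mulVec]
      map_smul' := fun c x => by simp [Matrix.smul_mulVec] }

theorem quadCLM_apply {ι : Type*} [Fintype ι] [DecidableEq ι] (ξ : ι → ℂ) (K : Matrix ι ι ℂ) :
    quadCLM ξ K = (star ξ ⬝ᵥ (K *ᵥ ξ)).re := rfl

theorem star_dotProduct_conj_mulVec {ι κ : Type*} [Fintype ι] [Fintype κ] (u : Matrix ι κ ℂ)
    (K : Matrix ι ι ℂ) (ξ : κ → ℂ) :
    star ξ ⬝ᵥ ((uᴴ * K * u) *ᵥ ξ) = star (u *ᵥ ξ) ⬝ᵥ (K *ᵥ (u *ᵥ ξ)) := by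
  rw [Matrix.star_mulVec, ← Matrix.mulVec_mulVec, ← Matrix.mulVec_mulVec, Matrix.dotProduct_mulVec]

/-- Here `u'` and `B'` denote a second solution and its coefficient, not derivatives. Equal
parameters give the monotonicity of the form, conjugate parameters a conservation law. -/
theorem hasDerivWithinAt_conj {u u' B B' : ℝ → Matrix (Fin m₁ ⊕ Fin m₂) (Fin m₁ ⊕ Fin m₂) ℂ}
    {s : Set ℝ} {x : ℝ} (h : HasDerivWithinAt u (B x * u x) s x)
    (h' : HasDerivWithinAt u' (B' x * u' x) s x) :
    HasDerivWithinAt (fun x => (u' x)ᴴ * jMat m₁ m₂ * u x)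
      ((u' x)ᴴ * ((B' x)ᴴ * jMat m₁ m₂ + jMat m₁ m₂ * B x) * u x) s x := by
  refine ((h'.star.mul_const (jMat m₁ m₂)).fun_mul h).congr_deriv ?_
  simp only [Matrix.star_eq_conjTranspose, Matrix.conjTranspose_mul, mul_add, add_mul, mul_assoc]

theorem hasDerivWithinAt_jForm {u B : ℝ → Matrix (Fin m₁ ⊕ Fin m₂) (Fin m₁ ⊕ Fin m₂) ℂ}
    {s : Set ℝ} {x : ℝ} (h : HasDerivWithinAt u (B x * u x) s x) (ξ : Fin m₁ ⊕ Fin m₂ → ℂ) :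
    HasDerivWithinAt (fun x => jForm (u x *ᵥ ξ))
      (star (u x *ᵥ ξ) ⬝ᵥ (((B x)ᴴ * jMat m₁ m₂ + jMat m₁ m₂ * B x) *ᵥ (u x *ᵥ ξ))).re s x := by
  have := (quadCLM ξ).hasFDerivAt.comp_hasDerivWithinAt x (hasDerivWithinAt_conj h h)
  simp only [quadCLM_apply, Function.comp_def, star_dotProduct_conj_mulVec] at this
  simpa only [jForm_eq_dotProduct] using this

/-- If `B'* j + j B = 0` then `u'* j u` is conserved. -/
theorem conj_mul_jMat_mul {u u' B B' : ℝ → Matrix (Fin m₁ ⊕ Fin m₂) (Fin m₁ ⊕ Fin m₂) ℂ} {T : ℝ}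
    (hT : 0 ≤ T) (h : ∀ t ∈ Icc 0 T, HasDerivWithinAt u (B t * u t) (Ici 0) t)
    (h' : ∀ t ∈ Icc 0 T, HasDerivWithinAt u' (B' t * u' t) (Ici 0) t)
    (hB : ∀ t, (B' t)ᴴ * jMat m₁ m₂ + jMat m₁ m₂ * B t = 0) (h0 : u 0 = 1) (h0' : u' 0 = 1) :
    (u' T)ᴴ * jMat m₁ m₂ * u T = jMat m₁ m₂ := by
  have hd : ∀ t ∈ Icc 0 T, HasDerivWithinAt (fun x => (u' x)ᴴ * jMat m₁ m₂ * u x) 0 (Ici 0) t :=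
    fun t ht => (hasDerivWithinAt_conj (h t ht) (h' t ht)).congr_deriv (by simp [hB])
  have := constant_of_has_deriv_right_zero
    (fun t ht => (hd t ht).continuousWithinAt.mono Icc_subset_Ici_self)
    (fun t ht => (hd t (Ico_subset_Icc_self ht)).mono (Ici_subset_Ici.2 ht.1)) T ⟨hT, le_rfl⟩
  simpa [h0, h0'] using this

theorem isUnit_of_conj {U U' : Matrix (Fin m₁ ⊕ Fin m₂) (Fin m₁ ⊕ Fin m₂) ℂ}
    (h : U'ᴴ * jMat m₁ m₂ * U = jMat m₁ m₂) : IsUnit U := by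
  refine IsUnit.of_mul_eq_one_right (jMat m₁ m₂ * (U'ᴴ * jMat m₁ m₂)) ?_
  rw [mul_assoc, h, jMat_mul_jMat]

/-- Pairing `z` with its conjugate removes the `Im z` term, so `u(z̄)* j u(z) = j`; this exhibits an
inverse of `u(z)`. -/
theorem coeffG_conj_jMat (w : Matrix (Fin m₁) (Fin m₂) ℂ) (z : ℂ) :
    (coeffG w (star z))ᴴ * jMat m₁ m₂ + jMat m₁ m₂ * coeffG w z = 0 := by
  unfold coeffG
  simp only [Matrix.conjTranspose_smul, Matrix.conjTranspose_add, Matrix.conjTranspose_mul,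
    jMat_conjTranspose, potential_conjTranspose, smul_mul_assoc, mul_smul_comm, add_mul, mul_add,
    mul_assoc, jMat_mul_jMat, ← mul_assoc (jMat m₁ m₂) (jMat m₁ m₂), one_mul, mul_one]
  match_scalars <;> simp

theorem coeffF_conj_jMat (w wx : Matrix (Fin m₁) (Fin m₂) ℂ) (z : ℂ) :
    (coeffF w wx (star z))ᴴ * jMat m₁ m₂ + jMat m₁ m₂ * coeffF w wx z = 0 := by
  unfold coeffF
  have hX := potential_mul_jMat wx
  simp only [Matrix.conjTranspose_smul, Matrix.conjTranspose_add, Matrix.conjTranspose_sub,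
    Matrix.conjTranspose_mul, Matrix.conjTranspose_pow,
    jMat_conjTranspose, potential_conjTranspose, smul_mul_assoc, mul_smul_comm, add_mul, mul_add,
    sub_mul, mul_sub,
    mul_assoc, jMat_mul_jMat, ← mul_assoc (jMat m₁ m₂) (jMat m₁ m₂), one_mul, mul_one, hX]
  match_scalars <;> simp

theorem IsFundamentalSolution.isUnit {w : ℝ → Matrix (Fin m₁) (Fin m₂) ℂ}
    (hw : ContinuousOn w (Ici 0)) {z : ℂ}
    {u : ℝ → Matrix (Fin m₁ ⊕ Fin m₂) (Fin m₁ ⊕ Fin m₂) ℂ} (hu : IsFundamentalSolution w z u)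
    {x : ℝ} (hx : 0 ≤ x) : IsUnit (u x) := by
  obtain ⟨u', hu'⟩ := exists_isFundamentalSolution hw (star z)
  exact isUnit_of_conj (conj_mul_jMat_mul (B := fun x => coeffG (w x) z)
    (B' := fun x => coeffG (w x) (star z)) hx (fun t ht => hu.2 t ht.1)
    (fun t ht => hu'.2 t ht.1) (fun t => coeffG_conj_jMat _ _) hu.1 hu'.1)

theorem IsTimeEvolution.isUnit {a : EReal} {v : ℝ → ℝ → Matrix (Fin m₁) (Fin m₂) ℂ}
    {R : ℝ → ℝ → ℂ → Matrix (Fin m₁ ⊕ Fin m₂) (Fin m₁ ⊕ Fin m₂) ℂ} (hR : IsTimeEvolution a v R)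
    {x t : ℝ} (hx : 0 ≤ x) (ht : 0 ≤ t) (hta : (t : EReal) < a) (z : ℂ) : IsUnit (R x t z) := by
  refine isUnit_of_conj (conj_mul_jMat_mul (u := fun t => R x t z) (u' := fun t => R x t (star z))
    (B := fun t => coeffF (v x t) (partialX v x t) z)
    (B' := fun t => coeffF (v x t) (partialX v x t) (star z)) ht
    (fun s hs => (hR x z hx).2 s hs.1 (timeInterval_subset hta hs).2)
    (fun s hs => (hR x _ hx).2 s hs.1 (timeInterval_subset hta hs).2)
    (fun t => coeffF_conj_jMat _ _ _) (hR x z hx).1 (hR x _ hx).1)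

end Forms

/-! ### Nested Weyl discs and the Weyl integral. -/

section WeylDisc

variable {m₁ m₂ : ℕ} {w : ℝ → Matrix (Fin m₁) (Fin m₂) ℂ} {z : ℂ}
  {u : ℝ → Matrix (Fin m₁ ⊕ Fin m₂) (Fin m₁ ⊕ Fin m₂) ℂ}

theorem IsFundamentalSolution.hasDerivWithinAt_jForm (hu : IsFundamentalSolution w z u)
    (ξ : Fin m₁ ⊕ Fin m₂ → ℂ) {x : ℝ} (hx : 0 ≤ x) :
    HasDerivWithinAt (fun x => jForm (u x *ᵥ ξ)) (-2 * z.im * normSqVec (u x *ᵥ ξ)) (Ici 0) x := by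
  refine (DNLS.hasDerivWithinAt_jForm (B := fun x => coeffG (w x) z) (hu.2 x hx) ξ).congr_deriv ?_
  rw [coeffG_jMat, Matrix.smul_mulVec, Matrix.one_mulVec, dotProduct_smul, smul_eq_mul,
    Complex.re_ofReal_mul, ← normSqVec_eq_dotProduct]

theorem antitoneOn_of_hasDerivWithinAt_Ici {f f' : ℝ → ℝ}
    (hf : ∀ x, 0 ≤ x → HasDerivWithinAt f (f' x) (Ici 0) x) (hf' : ∀ x, 0 ≤ x → f' x ≤ 0) :
    AntitoneOn f (Ici 0) := by
  refine antitoneOn_of_hasDerivWithinAt_nonpos (f' := f') (convex_Ici 0)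
    (fun x hx => (hf x hx).continuousWithinAt) (fun x hx => ?_) (fun x hx => ?_)
  · rw [interior_Ici] at hx ⊢
    exact (hf x (le_of_lt hx)).mono Ioi_subset_Ici_self
  · rw [interior_Ici] at hx
    exact hf' x (le_of_lt hx)

theorem IsFundamentalSolution.antitoneOn_jForm (hu : IsFundamentalSolution w z u)
    (hz : 0 < z.im) (ξ : Fin m₁ ⊕ Fin m₂ → ℂ) :
    AntitoneOn (fun x => jForm (u x *ᵥ ξ)) (Ici 0) :=
  antitoneOn_of_hasDerivWithinAt_Ici (fun _ hx => hu.hasDerivWithinAt_jForm ξ hx)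
    fun x _ => by nlinarith [mul_nonneg hz.le (normSqVec_nonneg (u x *ᵥ ξ))]

/-- The form starts at `-|d|²` and decreases, while its negative is at most the squared norm. Such
solutions therefore never decay. -/
theorem IsFundamentalSolution.le_normSqVec (hu : IsFundamentalSolution w z u)
    (hz : 0 < z.im) (d : Fin m₂ → ℂ) {x : ℝ} (hx : 0 ≤ x) :
    normSqVec d ≤ normSqVec (u x *ᵥ Sum.elim 0 d) := by
  have h1 := hu.antitoneOn_jForm hz (Sum.elim 0 d) self_mem_Ici hx hx
  simp only [hu.1, Matrix.one_mulVec, jForm_elim, normSqVec_zero] at h1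
  linarith [neg_jForm_le (u x *ᵥ Sum.elim 0 d)]

theorem IsFundamentalSolution.jForm_le (hu : IsFundamentalSolution w z u)
    (hz : 0 < z.im) (d : Fin m₂ → ℂ) {x : ℝ} (hx : 0 ≤ x) :
    jForm (u x *ᵥ Sum.elim 0 d) ≤ -(normSqVec d * (1 + 2 * z.im * x)) := by
  have h := antitoneOn_of_hasDerivWithinAt_Ici
    (f := fun x => jForm (u x *ᵥ Sum.elim 0 d) + 2 * z.im * normSqVec d * x)
    (fun y hy => (hu.hasDerivWithinAt_jForm (Sum.elim 0 d) hy).fun_add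
      ((hasDerivAt_id y).const_mul (2 * z.im * normSqVec d)).hasDerivWithinAt)
    (fun y hy => by nlinarith [mul_le_mul_of_nonneg_left (hu.le_normSqVec hz d hy) hz.le])
    self_mem_Ici hx hx
  simp only [hu.1, Matrix.one_mulVec, jForm_elim, normSqVec_zero, mul_zero] at h
  linarith

/-- `C` lies in the Weyl disc determined by the value `U` of the fundamental solution. -/
def InWeylDisc (U : Matrix (Fin m₁ ⊕ Fin m₂) (Fin m₁ ⊕ Fin m₂) ℂ) (C : Matrix (Fin m₂) (Fin m₁) ℂ) :
    Prop :=
  ∀ c : Fin m₁ → ℂ, 0 ≤ jForm (U *ᵥ Sum.elim c (C *ᵥ c))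

theorem InWeylDisc.of_le (hu : IsFundamentalSolution w z u) (hz : 0 < z.im)
    {C : Matrix (Fin m₂) (Fin m₁) ℂ} {x b : ℝ} (hx : 0 ≤ x) (hxb : x ≤ b)
    (h : InWeylDisc (u b) C) : InWeylDisc (u x) C := fun c =>
  (h c).trans (hu.antitoneOn_jForm hz _ hx (hx.trans hxb) hxb)

theorem sumElim_sub_mulVec (C C' : Matrix (Fin m₂) (Fin m₁) ℂ) (c : Fin m₁ → ℂ) :
    Sum.elim c (C *ᵥ c) - Sum.elim c (C' *ᵥ c) = Sum.elim (0 : Fin m₁ → ℂ) ((C - C') *ᵥ c) := by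
  ext (i | i) <;> simp [Matrix.sub_mulVec]

/-- Apply the parallelogram identity for the form at `b`. The right side is nonnegative, the sum
contributes at most its value at `0`, hence at most `4|c|²`, and the difference starts at `[0; (C -
C')c]`, so its form is negative and grows linearly in size. -/
theorem InWeylDisc.normSqVec_sub_le (hu : IsFundamentalSolution w z u) (hz : 0 < z.im)
    {C C' : Matrix (Fin m₂) (Fin m₁) ℂ} {b : ℝ} (hb : 0 ≤ b)
    (h : InWeylDisc (u b) C) (h' : InWeylDisc (u b) C') (c : Fin m₁ → ℂ) :
    normSqVec ((C - C') *ᵥ c) * (1 + 2 * z.im * b) ≤ 4 * normSqVec c := by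
  have h1 := jForm_parallelogram (u b *ᵥ Sum.elim c (C *ᵥ c)) (u b *ᵥ Sum.elim c (C' *ᵥ c))
  rw [← Matrix.mulVec_sub, ← Matrix.mulVec_add, sumElim_sub_mulVec] at h1
  have h2 := hu.jForm_le hz ((C - C') *ᵥ c) hb
  have h3 := hu.antitoneOn_jForm hz (Sum.elim c (C *ᵥ c) + Sum.elim c (C' *ᵥ c)) self_mem_Ici hb hb
  have h4 : Sum.elim c (C *ᵥ c) + Sum.elim c (C' *ᵥ c)
      = Sum.elim ((2 : ℂ) • c) (C *ᵥ c + C' *ᵥ c) := by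
    ext (i | i) <;> simp [two_mul]
  have h5 : normSqVec ((2 : ℂ) • c) = 4 * normSqVec c := by
    simp only [normSqVec, Finset.mul_sum, Pi.smul_apply, norm_smul, mul_pow]
    norm_num
  simp only [hu.1, Matrix.one_mulVec] at h3
  rw [h4, jForm_elim, h5] at h3
  rw [h4] at h1
  linarith [h c, h' c, normSqVec_nonneg (C *ᵥ c + C' *ᵥ c)]

theorem InWeylDisc.norm_sub_le (hu : IsFundamentalSolution w z u) (hz : 0 < z.im)
    {C C' : Matrix (Fin m₂) (Fin m₁) ℂ} {b : ℝ} (hb : 0 ≤ b)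
    (h : InWeylDisc (u b) C) (h' : InWeylDisc (u b) C') :
    ‖C - C'‖ ≤ √(4 / (1 + 2 * z.im * b)) := by
  have hpos : 0 < 1 + 2 * z.im * b := by positivity
  refine l2_opNorm_le_of_normSqVec (Real.sqrt_nonneg _) fun c => ?_
  rw [Real.sq_sqrt (by positivity), div_mul_eq_mul_div, le_div_iff₀ hpos]
  exact h.normSqVec_sub_le hu hz hb h' c

theorem tendsto_sqrt_weylRadius {k : ℝ} (hk : 0 < k) :
    Tendsto (fun b : ℝ => √(4 / (1 + k * b))) atTop (𝓝 0) := by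
  have h1 : Tendsto (fun b : ℝ => 1 + k * b) atTop atTop :=
    tendsto_atTop_add_const_left _ _ (tendsto_id.const_mul_atTop hk)
  simpa only [Real.sqrt_zero, Function.comp_def] using
    (Real.continuous_sqrt.tendsto 0).comp (h1.const_div_atTop 4)

theorem eq_of_inWeylDisc (hu : IsFundamentalSolution w z u) (hz : 0 < z.im)
    {C C' : Matrix (Fin m₂) (Fin m₁) ℂ} (h : ∀ x, 0 < x → InWeylDisc (u x) C)
    (h' : ∀ x, 0 < x → InWeylDisc (u x) C') : C = C' := by
  have : ‖C - C'‖ ≤ 0 := by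
    refine ge_of_tendsto (tendsto_sqrt_weylRadius (k := 2 * z.im) (by positivity)) ?_
    filter_upwards [eventually_gt_atTop 0] with b hb
    exact (h b hb).norm_sub_le hu hz hb.le (h' b hb)
  exact sub_eq_zero.1 (norm_le_zero_iff.1 this)

theorem weylIntegrand_eq (U : Matrix (Fin m₁ ⊕ Fin m₂) (Fin m₁ ⊕ Fin m₂) ℂ)
    (C : Matrix (Fin m₂) (Fin m₁) ℂ) : weylIntegrand U C =
      (U * Matrix.fromRows (1 : Matrix (Fin m₁) (Fin m₁) ℂ) C)ᴴ * (U * Matrix.fromRows (1 : Matrix (Fin m₁) (Fin m₁) ℂ) C) := by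
  rw [weylIntegrand, Matrix.conjTranspose_mul, Matrix.conjTranspose_fromRows_eq_fromCols_conjTranspose,
    Matrix.conjTranspose_one]
  simp only [Matrix.mul_assoc]

theorem mul_fromRows_mulVec (U : Matrix (Fin m₁ ⊕ Fin m₂) (Fin m₁ ⊕ Fin m₂) ℂ)
    (C : Matrix (Fin m₂) (Fin m₁) ℂ) (c : Fin m₁ → ℂ) :
    (U * Matrix.fromRows (1 : Matrix (Fin m₁) (Fin m₁) ℂ) C) *ᵥ c = U *ᵥ Sum.elim c (C *ᵥ c) := by
  rw [← Matrix.mulVec_mulVec, Matrix.fromRows_mulVec, Matrix.one_mulVec]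

theorem quadCLM_weylIntegrand (U : Matrix (Fin m₁ ⊕ Fin m₂) (Fin m₁ ⊕ Fin m₂) ℂ)
    (C : Matrix (Fin m₂) (Fin m₁) ℂ) (c : Fin m₁ → ℂ) :
    quadCLM c (weylIntegrand U C) = normSqVec (U *ᵥ Sum.elim c (C *ᵥ c)) := by
  have h := star_dotProduct_conj_mulVec (U * Matrix.fromRows (1 : Matrix (Fin m₁) (Fin m₁) ℂ) C) 1 c
  rw [Matrix.mul_one, Matrix.one_mulVec] at h
  rw [quadCLM_apply, weylIntegrand_eq, h, mul_fromRows_mulVec, normSqVec_eq_dotProduct]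

/-- At most one matrix makes the Weyl integral finite. -/
theorem eq_of_integrableOn_weylIntegrand (hu : IsFundamentalSolution w z u) (hz : 0 < z.im)
    {C C' : Matrix (Fin m₂) (Fin m₁) ℂ}
    (h : IntegrableOn (fun x => weylIntegrand (u x) C) (Ioi 0))
    (h' : IntegrableOn (fun x => weylIntegrand (u x) C') (Ioi 0)) : C = C' := by
  have key : ∀ c, (C - C') *ᵥ c = 0 := by
    intro c
    have i1 := (quadCLM c).integrable_comp h
    have i2 := (quadCLM c).integrable_comp h'
    simp only [quadCLM_weylIntegrand] at i1 i2
    -- The difference of two square-integrable solutions is square-integrable but does not decay, so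
    -- a constant is integrable on a half-line and must vanish.
    have i3 : IntegrableOn (fun _ : ℝ => normSqVec ((C - C') *ᵥ c)) (Ioi 0) := by
      refine ((i1.const_mul 2).add (i2.const_mul 2)).mono' (by fun_prop) ?_
      refine (ae_restrict_iff' measurableSet_Ioi).2 (ae_of_all _ fun x hx => ?_)
      rw [Real.norm_of_nonneg (normSqVec_nonneg _)]
      have h1 := hu.le_normSqVec hz ((C - C') *ᵥ c) (le_of_lt hx)
      have h2 := normSqVec_parallelogram (u x *ᵥ Sum.elim c (C *ᵥ c))
        (u x *ᵥ Sum.elim c (C' *ᵥ c))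
      rw [← Matrix.mulVec_sub, sumElim_sub_mulVec] at h2
      have h3 := normSqVec_nonneg (u x *ᵥ Sum.elim c (C *ᵥ c) + u x *ᵥ Sum.elim c (C' *ᵥ c))
      simp only [Pi.add_apply]
      linarith
    rw [integrableOn_const_iff] at i3
    rcases i3 with h0 | h0
    · exact eq_zero_of_normSqVec_le (le_of_eq (by simpa using h0))
    · simp at h0
  refine sub_eq_zero.1 (Matrix.ext_of_mulVec_single fun i => ?_)
  rw [key, Matrix.zero_mulVec]

theorem continuousOn_fundamentalSolution (hu : IsFundamentalSolution w z u) :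
    ContinuousOn u (Ici 0) := fun x hx => (hu.2 x hx).continuousWithinAt

/-- The form is decreasing and bounded below by `0`, so its derivative `-2 Im z |uξ|²` has a finite
integral. -/
theorem integrableOn_normSqVec (hu : IsFundamentalSolution w z u) (hz : 0 < z.im)
    {ξ : Fin m₁ ⊕ Fin m₂ → ℂ} (h : ∀ x, 0 ≤ x → 0 ≤ jForm (u x *ᵥ ξ)) :
    IntegrableOn (fun x => normSqVec (u x *ᵥ ξ)) (Ioi 0) := by
  have hanti := hu.antitoneOn_jForm hz ξ
  obtain ⟨l, hl⟩ : ∃ l, Tendsto (fun x => jForm (u x *ᵥ ξ)) atTop (𝓝 l) := by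
    have ha : Antitone fun x : ℝ => jForm (u (max x 0) *ᵥ ξ) := fun x y hxy =>
      hanti (mem_Ici.2 (le_max_right x 0)) (mem_Ici.2 (le_max_right y 0)) (max_le_max_right 0 hxy)
    refine ⟨_, (tendsto_atTop_ciInf ha ⟨0, ?_⟩).congr' ?_⟩
    · rintro _ ⟨x, rfl⟩
      exact h _ (le_max_right _ _)
    · filter_upwards [eventually_ge_atTop 0] with x hx
      rw [max_eq_left hx]
  have h1 : IntegrableOn (fun x => 2 * z.im * normSqVec (u x *ᵥ ξ)) (Ioi 0) := by
    refine integrableOn_Ioi_deriv_of_nonneg (g := fun x => -jForm (u x *ᵥ ξ)) (l := -l)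
      (hu.hasDerivWithinAt_jForm ξ le_rfl).continuousWithinAt.neg (fun x hx => ?_)
      (fun x _ => by have := normSqVec_nonneg (u x *ᵥ ξ); positivity) hl.neg
    refine ((hu.hasDerivWithinAt_jForm ξ (le_of_lt hx)).hasDerivAt (Ici_mem_nhds hx)).fun_neg.congr_deriv ?_
    ring
  have h2 := h1.const_mul (2 * z.im)⁻¹
  refine h2.congr (ae_of_all _ fun x => ?_)
  field_simp

/-- The integrand is a Gram matrix, so each entry is dominated by the sum of two diagonal entries,
which are squared norms of solutions. -/
theorem integrableOn_weylIntegrand (hu : IsFundamentalSolution w z u) (hz : 0 < z.im)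
    {C : Matrix (Fin m₂) (Fin m₁) ℂ} (h : ∀ x, 0 ≤ x → InWeylDisc (u x) C) :
    IntegrableOn (fun x => weylIntegrand (u x) C) (Ioi 0) := by
  have hcont : ContinuousOn (fun x => weylIntegrand (u x) C) (Ioi 0) := by
    have h1 : Continuous fun U : Matrix (Fin m₁ ⊕ Fin m₂) (Fin m₁ ⊕ Fin m₂) ℂ =>
        weylIntegrand U C := by
      unfold weylIntegrand
      exact ((continuous_const.matrix_mul continuous_id.matrix_conjTranspose).matrix_mul
        continuous_id).matrix_mul continuous_const
    exact h1.comp_continuousOn (f := u)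
      ((continuousOn_fundamentalSolution hu).mono Ioi_subset_Ici_self)
  have hent : ∀ k l, IntegrableOn (fun x => weylIntegrand (u x) C k l) (Ioi 0) := by
    intro k l
    have i1 := fun c => integrableOn_normSqVec hu hz (ξ := Sum.elim c (C *ᵥ c))
      fun x hx => h x hx c
    refine ((i1 (Pi.single k 1)).add (i1 (Pi.single l 1))).mono' ?_ (ae_of_all _ fun x => ?_)
    · exact (((continuous_id.matrix_elem k l).comp_continuousOn
        (f := fun x => weylIntegrand (u x) C) hcont).aestronglyMeasurable measurableSet_Ioi)
    · obtain ⟨P, hP⟩ : ∃ P : Matrix (Fin m₁ ⊕ Fin m₂) (Fin m₁) ℂ,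
          P = u x * Matrix.fromRows (1 : Matrix (Fin m₁) (Fin m₁) ℂ) C := ⟨_, rfl⟩
      have hcol : ∀ k, normSqVec (u x *ᵥ Sum.elim (Pi.single k 1) (C *ᵥ Pi.single k 1)) =
          ∑ i, ‖P i k‖ ^ 2 := fun k => by
        rw [← mul_fromRows_mulVec, ← hP, Matrix.mulVec_single_one]; rfl
      rw [Pi.add_apply, hcol, hcol, weylIntegrand_eq, ← hP, Matrix.mul_apply,
        ← Finset.sum_add_distrib]
      refine (norm_sum_le _ _).trans (Finset.sum_le_sum fun i _ => ?_)
      rw [Matrix.conjTranspose_apply, norm_mul, norm_star]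
      nlinarith [sq_nonneg (‖P i k‖ - ‖P i l‖), sq_nonneg ‖P i k‖, sq_nonneg ‖P i l‖]
  have hsum : (fun x => weylIntegrand (u x) C) = fun x =>
      ∑ k, ∑ l, weylIntegrand (u x) C k l • Matrix.single k l (1 : ℂ) := by
    funext x
    conv_lhs => rw [Matrix.matrix_eq_sum_single (weylIntegrand (u x) C)]
    simp [Matrix.smul_single]
  rw [hsum]
  exact integrable_finsetSum _ fun k _ => integrable_finsetSum _ fun l _ =>
    (hent k l).smul_const _

end WeylDisc

/-! ### Holomorphic matrix functions. -/

section Holomorphy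

/-- The entries of a holomorphic matrix function are holomorphic, and conversely. -/
theorem differentiableOn_matrix_iff {m n : Type*} [Fintype m] [Fintype n] [DecidableEq m]
    [DecidableEq n] {f : ℂ → Matrix m n ℂ} {s : Set ℂ} :
    DifferentiableOn ℂ f s ↔ ∀ i j, DifferentiableOn ℂ (fun z => f z i j) s := by
  constructor
  · intro h i j
    have hc : Differentiable ℂ fun A : Matrix m n ℂ => A i j :=
      (LinearMap.toContinuousLinearMap
        { toFun := fun A : Matrix m n ℂ => A i j
          map_add' := fun _ _ => rfl
          map_smul' := fun _ _ => rfl }).differentiable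
    exact hc.comp_differentiableOn h
  · intro h
    have hsum : f = fun z => ∑ k, ∑ l, f z k l • Matrix.single k l (1 : ℂ) := by
      funext z
      conv_lhs => rw [Matrix.matrix_eq_sum_single (f z)]
      simp [Matrix.smul_single]
    rw [hsum]
    exact DifferentiableOn.fun_sum fun k _ => DifferentiableOn.fun_sum fun l _ =>
      (h k l).smul_const _

theorem differentiableOn_matrix_mul {l m n : Type*} [Fintype l] [Fintype m] [Fintype n]
    [DecidableEq l] [DecidableEq m] [DecidableEq n]
    {f : ℂ → Matrix l m ℂ} {g : ℂ → Matrix m n ℂ} {s : Set ℂ} (hf : DifferentiableOn ℂ f s)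
    (hg : DifferentiableOn ℂ g s) : DifferentiableOn ℂ (fun z => f z * g z) s := by
  rw [differentiableOn_matrix_iff] at *
  intro i j
  simp only [Matrix.mul_apply]
  exact DifferentiableOn.fun_sum fun k _ => (hf i k).fun_mul (hg k j)

theorem differentiableOn_matrix_inv {n : Type*} [Fintype n] [DecidableEq n]
    {f : ℂ → Matrix n n ℂ} {s : Set ℂ} (hf : DifferentiableOn ℂ f s)
    (hu : ∀ z ∈ s, IsUnit (f z)) : DifferentiableOn ℂ (fun z => (f z)⁻¹) s := by
  intro z hz
  have h := differentiableAt_inverse (𝕜 := ℂ) (hu z hz)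
  simp only [Matrix.nonsing_inv_eq_ringInverse]
  exact DifferentiableAt.comp_differentiableWithinAt z h (hf z hz)

end Holomorphy

/-! ### Existence and uniqueness of the Weyl function. -/

section WeylFunction

variable {m₁ m₂ : ℕ} {w : ℝ → Matrix (Fin m₁) (Fin m₂) ℂ}

theorem isOpen_upperHalf : IsOpen upperHalf := isOpen_lt continuous_const Complex.continuous_im

theorem convex_upperHalf : Convex ℝ upperHalf := convex_halfSpace_im_gt 0

theorem mulVec_sumElim_eq_blocks (U : Matrix (Fin m₁ ⊕ Fin m₂) (Fin m₁ ⊕ Fin m₂) ℂ)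
    (c : Fin m₁ → ℂ) (d : Fin m₂ → ℂ) : U *ᵥ Sum.elim c d =
      Sum.elim (U.toBlocks₁₁ *ᵥ c + U.toBlocks₁₂ *ᵥ d) (U.toBlocks₂₁ *ᵥ c + U.toBlocks₂₂ *ᵥ d) := by
  conv_lhs => rw [← Matrix.fromBlocks_toBlocks U]
  exact Matrix.fromBlocks_mulVec ..

theorem isUnit_of_mulVec_eq_zero {n : ℕ} {A : Matrix (Fin n) (Fin n) ℂ}
    (h : ∀ c, A *ᵥ c = 0 → c = 0) : IsUnit A := by
  rw [← Matrix.mulVec_injective_iff_isUnit]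
  intro c c' hc
  refine sub_eq_zero.1 (h _ ?_)
  rw [Matrix.mulVec_sub, sub_eq_zero]
  exact hc

theorem mulVec_mul_inv {A : Matrix (Fin m₁) (Fin m₁) ℂ} (hA : IsUnit A)
    (B : Matrix (Fin m₂) (Fin m₁) ℂ) (c : Fin m₁ → ℂ) :
    Sum.elim c ((B * A⁻¹) *ᵥ c) = Sum.elim (A *ᵥ (A⁻¹ *ᵥ c)) (B *ᵥ (A⁻¹ *ᵥ c)) := by
  rw [Matrix.mulVec_mulVec, Matrix.mulVec_mulVec,
    Matrix.mul_nonsing_inv _ ((Matrix.isUnit_iff_isUnit_det _).1 hA), Matrix.one_mulVec]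

/-- A distinguished point of the Weyl disc at `b`, obtained by transporting `[I; 0]` back to `0`. -/
noncomputable def discPoint (U : Matrix (Fin m₁ ⊕ Fin m₂) (Fin m₁ ⊕ Fin m₂) ℂ) :
    Matrix (Fin m₂) (Fin m₁) ℂ :=
  (U⁻¹).toBlocks₂₁ * ((U⁻¹).toBlocks₁₁)⁻¹

theorem IsFundamentalSolution.mulVec_inv_blocks (hw : ContinuousOn w (Ici 0)) {z : ℂ}
    {u : ℝ → Matrix (Fin m₁ ⊕ Fin m₂) (Fin m₁ ⊕ Fin m₂) ℂ} (hu : IsFundamentalSolution w z u)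
    {b : ℝ} (hb : 0 ≤ b) (c : Fin m₁ → ℂ) :
    u b *ᵥ Sum.elim (((u b)⁻¹).toBlocks₁₁ *ᵥ c) (((u b)⁻¹).toBlocks₂₁ *ᵥ c) = Sum.elim c 0 := by
  have h := mulVec_sumElim_eq_blocks (u b)⁻¹ c 0
  simp only [Matrix.mulVec_zero, add_zero] at h
  rw [← h, Matrix.mulVec_mulVec,
    Matrix.mul_nonsing_inv _ ((Matrix.isUnit_iff_isUnit_det _).1 (hu.isUnit hw hb)),
    Matrix.one_mulVec]

/-- The solution with value `[c; 0]` at `b` has form `|c|²` there, hence at least that at `0`. If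
its upper block at `0` vanished, the form there would be nonpositive. -/
theorem IsFundamentalSolution.isUnit_inv_block (hw : ContinuousOn w (Ici 0)) {z : ℂ}
    {u : ℝ → Matrix (Fin m₁ ⊕ Fin m₂) (Fin m₁ ⊕ Fin m₂) ℂ} (hu : IsFundamentalSolution w z u)
    (hz : 0 < z.im) {b : ℝ} (hb : 0 ≤ b) : IsUnit ((u b)⁻¹).toBlocks₁₁ := by
  refine isUnit_of_mulVec_eq_zero fun c hc => ?_
  have h1 := hu.antitoneOn_jForm hz
    (Sum.elim (((u b)⁻¹).toBlocks₁₁ *ᵥ c) (((u b)⁻¹).toBlocks₂₁ *ᵥ c)) self_mem_Ici hb hb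
  simp only [hu.1, Matrix.one_mulVec, hu.mulVec_inv_blocks hw hb] at h1
  rw [jForm_elim, jForm_elim, hc, normSqVec_zero, normSqVec_zero] at h1
  exact eq_zero_of_normSqVec_le (by linarith [normSqVec_nonneg (((u b)⁻¹).toBlocks₂₁ *ᵥ c)])

theorem IsFundamentalSolution.inWeylDisc_discPoint (hw : ContinuousOn w (Ici 0)) {z : ℂ}
    {u : ℝ → Matrix (Fin m₁ ⊕ Fin m₂) (Fin m₁ ⊕ Fin m₂) ℂ} (hu : IsFundamentalSolution w z u)
    (hz : 0 < z.im) {b : ℝ} (hb : 0 ≤ b) : InWeylDisc (u b) (discPoint (u b)) := by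
  intro c
  rw [discPoint, mulVec_mul_inv (hu.isUnit_inv_block hw hz hb), hu.mulVec_inv_blocks hw hb,
    jForm_elim, normSqVec_zero, sub_zero]
  exact normSqVec_nonneg _

theorem isClosed_inWeylDisc (U : Matrix (Fin m₁ ⊕ Fin m₂) (Fin m₁ ⊕ Fin m₂) ℂ) :
    IsClosed {C : Matrix (Fin m₂) (Fin m₁) ℂ | InWeylDisc U C} := by
  simp only [InWeylDisc, ofPred_forall]
  refine isClosed_iInter fun c => isClosed_le continuous_const ?_
  have h : Continuous fun C : Matrix (Fin m₂) (Fin m₁) ℂ => (Sum.elim c (C *ᵥ c) : _ → ℂ) := by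
    refine continuous_pi fun i => ?_
    rcases i with i | i
    · exact continuous_const
    · exact (continuous_apply i).comp (continuous_id.matrix_mulVec continuous_const)
  exact continuous_jForm.comp (Continuous.matrix_mulVec continuous_const h)

/-- The holomorphic limit of the Weyl discs. -/
theorem exists_differentiableOn_inWeylDisc (hw : ContinuousOn w (Ici 0)) :
    ∃ φ : ℂ → Matrix (Fin m₂) (Fin m₁) ℂ, DifferentiableOn ℂ φ upperHalf ∧
      ∀ z ∈ upperHalf, ∀ u, IsFundamentalSolution w z u → ∀ x, 0 ≤ x → InWeylDisc (u x) (φ z) := by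
  choose u hu using fun z => exists_isFundamentalSolution hw z
  let f : ℕ → ℂ → Matrix (Fin m₂) (Fin m₁) ℂ := fun n z => discPoint (u z n)
  have hf : ∀ n, DifferentiableOn ℂ (f n) upperHalf := by
    intro n
    have h1 : DifferentiableOn ℂ (fun z => (u z n)⁻¹) upperHalf :=
      differentiableOn_matrix_inv
        (differentiable_fundamentalSolution hw hu n.cast_nonneg).differentiableOn
        fun z _ => (hu z).isUnit hw n.cast_nonneg
    rw [differentiableOn_matrix_iff] at h1
    refine differentiableOn_matrix_mul (differentiableOn_matrix_iff.2 fun i j => h1 _ _)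
      (differentiableOn_matrix_inv (differentiableOn_matrix_iff.2 fun i j => h1 _ _) ?_)
    exact fun z hz => (hu z).isUnit_inv_block hw hz n.cast_nonneg
  have hdisc : ∀ z ∈ upperHalf, ∀ (x : ℝ) (n : ℕ), 0 ≤ x → x ≤ n → InWeylDisc (u z x) (f n z) :=
    fun z hz x n hx hxn => InWeylDisc.of_le (hu z) hz hx hxn
      ((hu z).inWeylDisc_discPoint hw hz n.cast_nonneg)
  have hrad : ∀ k : ℝ, 0 < k → Tendsto (fun n : ℕ => √(4 / (1 + k * n))) atTop (𝓝 0) :=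
    fun k hk => (tendsto_sqrt_weylRadius hk).comp tendsto_natCast_atTop_atTop
  have hlim : ∀ z, ∃ C, z ∈ upperHalf → Tendsto (fun n => f n z) atTop (𝓝 C) := by
    intro z
    by_cases hz : z ∈ upperHalf
    · have hz' : 0 < z.im := hz
      have hc : CauchySeq fun n => f n z := by
        refine cauchySeq_of_le_tendsto_0' _ (fun n k hnk => ?_)
          (hrad (2 * z.im) (by positivity))
        rw [dist_eq_norm]
        -- By nesting, all later points lie in the disc at `n`.
        exact (hdisc z hz n n n.cast_nonneg le_rfl).norm_sub_le (hu z) hz n.cast_nonneg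
          (hdisc z hz n k n.cast_nonneg (Nat.cast_le.2 hnk))
      obtain ⟨C, hC⟩ := cauchySeq_tendsto_of_complete hc
      exact ⟨C, fun _ => hC⟩
    · exact ⟨0, fun h => absurd h hz⟩
  choose φ hφ using hlim
  have hφdisc : ∀ z ∈ upperHalf, ∀ x, 0 ≤ x → InWeylDisc (u z x) (φ z) := by
    intro z hz x hx
    refine (isClosed_inWeylDisc (u z x)).mem_of_tendsto (hφ z hz) ?_
    filter_upwards [eventually_ge_atTop ⌈x⌉₊] with n hn
    exact hdisc z hz x n hx (Nat.ceil_le.1 hn)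
  refine ⟨φ, ?_, fun z hz v hv x hx => ?_⟩
  · refine TendstoLocallyUniformlyOn.differentiableOn (F := f) (φ := atTop) ?_
      (Eventually.of_forall hf) isOpen_upperHalf
    rw [Metric.tendstoLocallyUniformlyOn_iff]
    intro ε hε z₀ hz₀
    have hz₀' : 0 < z₀.im := hz₀
    -- On this half-plane `2 Im z > Im z₀`, so one bound on the diameters serves all `z`.
    refine ⟨{z | z₀.im / 2 < z.im}, mem_nhdsWithin_of_mem_nhds
      ((isOpen_lt continuous_const Complex.continuous_im).mem_nhds (half_lt_self hz₀')), ?_⟩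
    filter_upwards [(hrad z₀.im hz₀').eventually (gt_mem_nhds hε)] with n hn z hz
    have hz' : z₀.im / 2 < z.im := hz
    have hzu : z ∈ upperHalf := (half_pos hz₀').trans hz'
    rw [dist_eq_norm]
    refine lt_of_le_of_lt (((hφdisc z hzu n n.cast_nonneg).norm_sub_le (hu z) hzu n.cast_nonneg
      (hdisc z hzu n n n.cast_nonneg le_rfl)).trans (Real.sqrt_le_sqrt ?_)) hn
    gcongr
    linarith
  · rw [hv.eq hw (hu z) hx]
    exact hφdisc z hz x hx

theorem exists_isWeylFunction (hw : ContinuousOn w (Ici 0)) :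
    ∃ φ : ℂ → Matrix (Fin m₂) (Fin m₁) ℂ, IsWeylFunction w φ ∧
      ∀ z ∈ upperHalf, ∀ u, IsFundamentalSolution w z u → ∀ x, 0 ≤ x → InWeylDisc (u x) (φ z) := by
  obtain ⟨φ, hd, hφ⟩ := exists_differentiableOn_inWeylDisc hw
  refine ⟨φ, ⟨hd, fun z hz => ?_⟩, hφ⟩
  obtain ⟨u, hu⟩ := exists_isFundamentalSolution hw z
  exact ⟨u, hu, integrableOn_weylIntegrand hu hz (hφ z hz u hu)⟩

theorem IsWeylFunction.eqOn (hw : ContinuousOn w (Ici 0))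
    {φ ψ : ℂ → Matrix (Fin m₂) (Fin m₁) ℂ} (hφ : IsWeylFunction w φ) (hψ : IsWeylFunction w ψ) :
    EqOn φ ψ upperHalf := by
  intro z hz
  obtain ⟨u, hu, hi⟩ := hφ.2 z hz
  obtain ⟨u', hu', hi'⟩ := hψ.2 z hz
  refine eq_of_integrableOn_weylIntegrand hu hz hi (hi'.congr_fun (fun x hx => ?_) measurableSet_Ioi)
  simp only [hu'.eq hw hu (le_of_lt hx)]

/-- The definition gives only integrability; disc membership comes from uniqueness, by comparison
with the limit of the discs. -/
theorem IsWeylFunction.inWeylDisc (hw : ContinuousOn w (Ici 0))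
    {φ : ℂ → Matrix (Fin m₂) (Fin m₁) ℂ} (hφ : IsWeylFunction w φ) {z : ℂ} (hz : z ∈ upperHalf)
    {u : ℝ → Matrix (Fin m₁ ⊕ Fin m₂) (Fin m₁ ⊕ Fin m₂) ℂ} (hu : IsFundamentalSolution w z u)
    {x : ℝ} (hx : 0 ≤ x) : InWeylDisc (u x) (φ z) := by
  obtain ⟨ψ, hψ, hd⟩ := exists_isWeylFunction hw
  rw [hφ.eqOn hw hψ hz]
  exact hd z hz u hu x hx

end WeylFunction

/-! ### Evolution of the Weyl function. -/

section Evolution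

variable {m₁ m₂ : ℕ} {a : EReal} {v : ℝ → ℝ → Matrix (Fin m₁) (Fin m₂) ℂ}
  {R : ℝ → ℝ → ℂ → Matrix (Fin m₁ ⊕ Fin m₂) (Fin m₁ ⊕ Fin m₂) ℂ}

/-- For `Re z` large, `R` is `j`-expanding, whatever the size of `v_x`. -/
theorem IsTimeEvolution.jForm_le (hR : IsTimeEvolution a v R) {x t M : ℝ} (hx : 0 ≤ x)
    (ht : 0 ≤ t) (hta : (t : EReal) < a) (hM : ∀ s, 0 ≤ s → s ≤ t → ‖v x s‖ ≤ M) {z : ℂ}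
    (hz : 0 < z.im) (hre : ‖potentialCLM m₁ m₂‖ * M ≤ 2 * z.re) (ξ : Fin m₁ ⊕ Fin m₂ → ℂ) :
    jForm ξ ≤ jForm (R x t z *ᵥ ξ) := by
  have hd : ∀ s ∈ Icc 0 t, HasDerivWithinAt (fun s => jForm (R x s z *ᵥ ξ))
      (star (R x s z *ᵥ ξ) ⬝ᵥ (((coeffF (v x s) (partialX v x s) z)ᴴ * jMat m₁ m₂ +
        jMat m₁ m₂ * coeffF (v x s) (partialX v x s) z) *ᵥ (R x s z *ᵥ ξ))).re (Ici 0) s :=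
    fun s hs => hasDerivWithinAt_jForm (B := fun s => coeffF (v x s) (partialX v x s) z)
      ((hR x z hx).2 s hs.1 (timeInterval_subset hta hs).2) ξ
  have hmono : MonotoneOn (fun s => jForm (R x s z *ᵥ ξ)) (Icc 0 t) := by
    refine monotoneOn_of_hasDerivWithinAt_nonneg (convex_Icc 0 t)
      (fun s hs => (hd s hs).continuousWithinAt.mono Icc_subset_Ici_self)
      (fun s hs => (hd s (interior_subset hs)).mono
        (interior_subset.trans Icc_subset_Ici_self)) (fun s hs => ?_)
    have hs' := interior_subset hs
    generalize R x s z *ᵥ ξ = y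
    rw [coeffF_jMat, Matrix.smul_mulVec, dotProduct_smul, smul_eq_mul, Complex.re_ofReal_mul,
      Matrix.add_mulVec, Matrix.smul_mulVec, Matrix.one_mulVec, dotProduct_add, dotProduct_smul,
      smul_eq_mul, Complex.add_re, Complex.re_ofReal_mul, ← normSqVec_eq_dotProduct]
    have h1 := abs_le.1 (abs_re_dotProduct_mulVec_le (potential (v x s)) y)
    have h2 : ‖potential (v x s)‖ ≤ 2 * z.re :=
      (((potentialCLM m₁ m₂).le_opNorm (v x s)).trans
        (mul_le_mul_of_nonneg_left (hM s hs'.1 hs'.2) (norm_nonneg _))).trans hre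
    have h3 := mul_le_mul_of_nonneg_right h2 (normSqVec_nonneg y)
    refine mul_nonneg (by positivity) ?_
    linarith [h1.1]
  simpa [(hR x z hx).1] using hmono ⟨le_rfl, ht⟩ ⟨ht, le_rfl⟩ ht

theorem timeEvolution_mulVec (U : Matrix (Fin m₁ ⊕ Fin m₂) (Fin m₁ ⊕ Fin m₂) ℂ)
    (C : Matrix (Fin m₂) (Fin m₁) ℂ) (c : Fin m₁ → ℂ) :
    U *ᵥ Sum.elim c (C *ᵥ c) = Sum.elim ((U.toBlocks₁₁ + U.toBlocks₁₂ * C) *ᵥ c)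
      ((U.toBlocks₂₁ + U.toBlocks₂₂ * C) *ᵥ c) := by
  rw [mulVec_sumElim_eq_blocks, Matrix.add_mulVec, Matrix.add_mulVec, Matrix.mulVec_mulVec,
    Matrix.mulVec_mulVec]

/-- If the upper block of `U [I; C]` controls the lower block, then it is invertible. -/
theorem isUnit_upper {U : Matrix (Fin m₁ ⊕ Fin m₂) (Fin m₁ ⊕ Fin m₂) ℂ} (hU : IsUnit U)
    {C : Matrix (Fin m₂) (Fin m₁) ℂ}
    (h : ∀ c, (U.toBlocks₁₁ + U.toBlocks₁₂ * C) *ᵥ c = 0 →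
      (U.toBlocks₂₁ + U.toBlocks₂₂ * C) *ᵥ c = 0) : IsUnit (U.toBlocks₁₁ + U.toBlocks₁₂ * C) := by
  refine isUnit_of_mulVec_eq_zero fun c hc => ?_
  have h1 := timeEvolution_mulVec U C c
  rw [hc, h c hc] at h1
  have h2 : Sum.elim c (C *ᵥ c) = 0 := by
    refine (Matrix.mulVec_injective_iff_isUnit.2 hU) ?_
    rw [h1, Matrix.mulVec_zero]
    ext (i | i) <;> rfl
  funext i
  exact congrFun h2 (Sum.inl i)

/-- The linear form of the evolution formula, in the part of `ℂ₊` where `R` is `j`-expanding. -/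
theorem weylFunction_mul_eq_of_re_large
    (hC1 : ContDiffOn ℝ 1 (fun p : ℝ × ℝ => v p.1 p.2) (semistrip a))
    (hNLS : SolvesDNLS a v) (hR : IsTimeEvolution a v R) {t M : ℝ}
    (ht : 0 ≤ t) (hta : (t : EReal) < a)
    (hM : ∀ x s : ℝ, 0 < x → 0 ≤ s → s ≤ t → ‖v x s‖ ≤ M)
    {φ₀ φ : ℂ → Matrix (Fin m₂) (Fin m₁) ℂ} (hφ₀ : IsWeylFunction (fun x => v x 0) φ₀)
    (hφ : IsWeylFunction (fun x => v x t) φ) {z : ℂ} (hz : z ∈ upperHalf)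
    (hre : ‖potentialCLM m₁ m₂‖ * M ≤ 2 * z.re) :
    φ z * ((R 0 t z).toBlocks₁₁ + (R 0 t z).toBlocks₁₂ * φ₀ z) =
      (R 0 t z).toBlocks₂₁ + (R 0 t z).toBlocks₂₂ * φ₀ z := by
  have h0a : ((0 : ℝ) : EReal) < a := lt_of_le_of_lt (EReal.coe_le_coe_iff.2 ht) hta
  have hw₀ : ContinuousOn (fun x => v x 0) (Ici 0) :=
    continuousOn_slice_fst hC1.continuousOn le_rfl h0a
  have hw : ContinuousOn (fun x => v x t) (Ici 0) :=
    continuousOn_slice_fst hC1.continuousOn ht hta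
  obtain ⟨u₀, hu₀⟩ := exists_isFundamentalSolution hw₀ z
  obtain ⟨u, hu⟩ := exists_isFundamentalSolution hw z
  have hpos : ∀ x, 0 < x → ∀ c, 0 ≤ jForm (u x *ᵥ (R 0 t z *ᵥ Sum.elim c (φ₀ z *ᵥ c))) := by
    intro x hx c
    rw [Matrix.mulVec_mulVec, fundamentalSolution_mul_timeEvolution hC1 hNLS hR hx.le ht hta hu₀ hu,
      ← Matrix.mulVec_mulVec]
    exact (hφ₀.inWeylDisc hw₀ hz hu₀ hx.le c).trans
      (hR.jForm_le hx.le ht hta (fun s => hM x s hx) hz hre _)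
  simp only [timeEvolution_mulVec (R 0 t z)] at hpos
  -- Since `v` is bounded only for `x > 0`, positivity is used at `x = 1` and carried back to `0` by
  -- monotonicity of the form.
  have hA := isUnit_upper (C := φ₀ z) (hR.isUnit le_rfl ht hta z) fun c hc => by
    have h1 := (hpos 1 one_pos c).trans (hu.antitoneOn_jForm hz _ self_mem_Ici
      (mem_Ici.2 zero_le_one) zero_le_one)
    simp only [hu.1, Matrix.one_mulVec] at h1
    rw [hc, jForm_elim, normSqVec_zero] at h1
    exact eq_zero_of_normSqVec_le (by linarith)
  have hdisc := fun x hx => hφ.inWeylDisc hw hz hu (x := x) (le_of_lt hx)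
  rw [eq_of_inWeylDisc hu hz hdisc (C' := ((R 0 t z).toBlocks₂₁ + (R 0 t z).toBlocks₂₂ * φ₀ z) *
    ((R 0 t z).toBlocks₁₁ + (R 0 t z).toBlocks₁₂ * φ₀ z)⁻¹) fun x hx c => ?_]
  · rw [Matrix.mul_assoc, Matrix.nonsing_inv_mul _ ((Matrix.isUnit_iff_isUnit_det _).1 hA),
      Matrix.mul_one]
  · rw [mulVec_mul_inv hA]
    exact hpos x hx _

/-- The linear form of the evolution formula on the whole half-plane. -/
theorem weylFunction_mul_eq
    (hC1 : ContDiffOn ℝ 1 (fun p : ℝ × ℝ => v p.1 p.2) (semistrip a))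
    (hNLS : SolvesDNLS a v) (hR : IsTimeEvolution a v R) {t M : ℝ}
    (ht : 0 ≤ t) (hta : (t : EReal) < a)
    (hM : ∀ x s : ℝ, 0 < x → 0 ≤ s → s ≤ t → ‖v x s‖ ≤ M)
    {φ₀ φ : ℂ → Matrix (Fin m₂) (Fin m₁) ℂ} (hφ₀ : IsWeylFunction (fun x => v x 0) φ₀)
    (hφ : IsWeylFunction (fun x => v x t) φ) {z : ℂ} (hz : z ∈ upperHalf) :
    φ z * ((R 0 t z).toBlocks₁₁ + (R 0 t z).toBlocks₁₂ * φ₀ z) =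
      (R 0 t z).toBlocks₂₁ + (R 0 t z).toBlocks₂₂ * φ₀ z := by
  have hRd : DifferentiableOn ℂ (fun z => R 0 t z) upperHalf :=
    (differentiable_timeEvolution hC1 hR le_rfl ht hta).differentiableOn
  have hRe := differentiableOn_matrix_iff.1 hRd
  have hup : DifferentiableOn ℂ
      (fun z => (R 0 t z).toBlocks₁₁ + (R 0 t z).toBlocks₁₂ * φ₀ z) upperHalf :=
    (differentiableOn_matrix_iff.2 fun i j => hRe _ _).add
      (differentiableOn_matrix_mul (differentiableOn_matrix_iff.2 fun i j => hRe _ _) hφ₀.1)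
  have hlow : DifferentiableOn ℂ
      (fun z => (R 0 t z).toBlocks₂₁ + (R 0 t z).toBlocks₂₂ * φ₀ z) upperHalf :=
    (differentiableOn_matrix_iff.2 fun i j => hRe _ _).add
      (differentiableOn_matrix_mul (differentiableOn_matrix_iff.2 fun i j => hRe _ _) hφ₀.1)
  have hleft := differentiableOn_matrix_mul hφ.1 hup
  let K := ‖potentialCLM m₁ m₂‖ * M
  -- A point of `ℂ₊` with a neighbourhood in which `2 Re z` exceeds `K`, so that the formula is
  -- already known near it.
  let z₁ : ℂ := ⟨K / 2 + 1, 1⟩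
  have hz₁ : z₁ ∈ upperHalf := show (0 : ℝ) < 1 from one_pos
  refine (hleft.analyticOnNhd isOpen_upperHalf).eqOn_of_preconnected_of_eventuallyEq
    (hlow.analyticOnNhd isOpen_upperHalf) convex_upperHalf.isPreconnected hz₁ ?_ hz
  have hre : {z : ℂ | K / 2 < z.re} ∈ 𝓝 z₁ :=
    (isOpen_lt continuous_const Complex.continuous_re).mem_nhds (lt_add_one (K / 2))
  filter_upwards [isOpen_upperHalf.mem_nhds hz₁, hre] with y hy hy'
  have hy'' : K / 2 < y.re := hy'
  exact weylFunction_mul_eq_of_re_large hC1 hNLS hR ht hta hM hφ₀ hφ hy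
    (by change K ≤ 2 * y.re; linarith)

end Evolution

end DNLS

theorem mainTheorem3 (m₁ m₂ : ℕ) (a : EReal)
    (v : ℝ → ℝ → Matrix (Fin m₁) (Fin m₂) ℂ)
    (hC1 : ContDiffOn ℝ 1 (fun p : ℝ × ℝ => v p.1 p.2) (DNLS.semistrip a))
    (hNLS : DNLS.SolvesDNLS a v)
    (hbdd : ∀ t : ℝ, 0 ≤ t → (t : EReal) < a →
      ∃ M : ℝ, ∀ x s : ℝ, 0 < x → 0 ≤ s → s ≤ t → ‖v x s‖ ≤ M) :
    -- the Weyl functions `φ(t, ·)` and the matrix function `R` are well defined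
    (∀ t : ℝ, 0 ≤ t → (t : EReal) < a →
      ∃ φ : ℂ → Matrix (Fin m₂) (Fin m₁) ℂ, DNLS.IsWeylFunction (fun x => v x t) φ ∧
        ∀ ψ : ℂ → Matrix (Fin m₂) (Fin m₁) ℂ, DNLS.IsWeylFunction (fun x => v x t) ψ →
          Set.EqOn ψ φ DNLS.upperHalf) ∧
    (∃ R : ℝ → ℝ → ℂ → Matrix (Fin m₁ ⊕ Fin m₂) (Fin m₁ ⊕ Fin m₂) ℂ,
      DNLS.IsTimeEvolution a v R) ∧
    -- the evolution formula
    ∀ (φ : ℝ → ℂ → Matrix (Fin m₂) (Fin m₁) ℂ)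
      (R : ℝ → ℝ → ℂ → Matrix (Fin m₁ ⊕ Fin m₂) (Fin m₁ ⊕ Fin m₂) ℂ),
      (∀ t : ℝ, 0 ≤ t → (t : EReal) < a → DNLS.IsWeylFunction (fun x => v x t) (φ t)) →
      DNLS.IsTimeEvolution a v R →
      ∀ t : ℝ, 0 ≤ t → (t : EReal) < a → ∀ z ∈ DNLS.upperHalf,
        IsUnit ((R 0 t z).toBlocks₁₁ + (R 0 t z).toBlocks₁₂ * φ 0 z) ∧
        φ t z = ((R 0 t z).toBlocks₂₁ + (R 0 t z).toBlocks₂₂ * φ 0 z) *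
          ((R 0 t z).toBlocks₁₁ + (R 0 t z).toBlocks₁₂ * φ 0 z)⁻¹ := by
  refine ⟨fun t ht hta => ?_, DNLS.exists_isTimeEvolution hC1, ?_⟩
  · have hw : ContinuousOn (fun x => v x t) (Ici 0) :=
      DNLS.continuousOn_slice_fst hC1.continuousOn ht hta
    obtain ⟨φ, hφ, -⟩ := DNLS.exists_isWeylFunction hw
    exact ⟨φ, hφ, fun ψ hψ => hψ.eqOn hw hφ⟩
  · intro φ R hφ hR t ht hta z hz
    obtain ⟨M, hM⟩ := hbdd t ht hta
    have h0a : ((0 : ℝ) : EReal) < a := lt_of_le_of_lt (EReal.coe_le_coe_iff.2 ht) hta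
    have key := DNLS.weylFunction_mul_eq hC1 hNLS hR ht hta hM (hφ 0 le_rfl h0a) (hφ t ht hta) hz
    -- The inverse-free identity shows that the lower block vanishes wherever the upper one does.
    have hA := DNLS.isUnit_upper (hR.isUnit le_rfl ht hta z) fun c hc => by
      rw [← key, ← Matrix.mulVec_mulVec, hc, Matrix.mulVec_zero]
    refine ⟨hA, ?_⟩
    rw [← key, Matrix.mul_assoc, Matrix.mul_nonsing_inv _ ((Matrix.isUnit_iff_isUnit_det _).1 hA),
      Matrix.mul_one]
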